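/- Let $A$ be a finite alphabet with $r=|A|\ge 2$ letters and let $F_r=F(A)$ be the free group on $A$. An $A$-graph is a set $V$ of vertices together with a set $E\subseteq V\times A\times V$ of labelled edges such that $(u,a,v),(u,a,v')\in E$ implies $v=v'$, and $(u,a,v),(u',a,v)\in E$ implies $u=u'$; an edge $(u,a,v)$ can be read from $u$ to $v$ with label $a$ and from $v$ to $u$ with label $a^{-1}$. A vertex is a leaf if it occurs at most once in the list of triples in $E$ (a triple $(v,a,v)$ counts as two occurrences of $v$). The Stallings graph of a finitely generated subgroup $H\le F_r$ is the unique (up to isomorphism) pair $(\Gamma,v_0)$, where $\Gamma$ is a finite connected $A$-graph and $v_0$ is a vertex of $\Gamma$, such that no vertex other than $v_0$ is a leaf, and such that a reduced word represents an element of $H$ if and only if it labels a loop at $v_0$ in $\Gamma$. The size of $H$ is the number of vertices of its Stallings graph; for each $n$ there are finitely many subgroups of size $n$. **Theorem.** Let $p_n$ be the probability that a subgroup $H$, chosen uniformly at random among the subgroups of $F_r$ of size $n$, contains no conjugate in $F_r$ of any letter $a\in A$. Then $$\lim_{n\to\infty} p_n = e^{-r}.$$ Moreover, if $H$ is a finitely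 generated subgroup of $F_r$ with Stallings graph $(\Gamma,v_0)$, then $H$ contains no conjugate of any letter if and only if no letter labels a loop in $\Gamma$, that is, $(u,a,u)\notin E$ for every vertex $u$ and every $a\in A$. -/

import Mathlib

/-- An `A`-graph on the vertex set `V`: a set of `A`-labelled edges `(u, a, v)` which is
deterministic and co-deterministic, that is, each letter acts as a partial injection on `V`. -/
structure AGraph (A : Type*) (V : Type*) where
  /-- The set of labelled edges. -/
  edges : Set (V × A × V)
  det : ∀ u a v v', (u, a, v) ∈ edges → (u, a, v') ∈ edges → v = v'
  codet : ∀ u u' a v, (u, a, v) ∈ edges → (u', a, v) ∈ edges → u = u'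

namespace AGraph

variable {A V : Type*}

/-- The underlying undirected graph (edge labels, directions, loops and multiplicities are
irrelevant for connectedness). -/
def underlying (Γ : AGraph A V) : SimpleGraph V :=
  SimpleGraph.fromRel (fun u v => ∃ a, (u, a, v) ∈ Γ.edges)

/-- The number of occurrences of `v` in the list of triples defining the edges;
an edge `(v, a, v)` counts twice. -/
noncomputable def degree (Γ : AGraph A V) (v : V) : ℕ∞ :=
  {e | e ∈ Γ.edges ∧ e.1 = v}.encard + {e | e ∈ Γ.edges ∧ e.2.2 = v}.encard

/-- A leaf is a vertex that occurs at most once in the triples defining the edges. -/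
def IsLeaf (Γ : AGraph A V) (v : V) : Prop :=
  Γ.degree v ≤ 1

/-- `(Γ, v)` is admissible: `Γ` is finite, connected and `v`-trim, that is, no vertex other
than `v` is a leaf. -/
structure Admissible (Γ : AGraph A V) (v : V) : Prop where
  finite : Finite V
  connected : Γ.underlying.Connected
  trim : ∀ w, w ≠ v → ¬ Γ.IsLeaf w

/-- One edge, read from `u` to `v`: an edge `(u, a, v)` is read from `u` to `v` with label `a`,
here `(a, true)`, and from `v` to `u` with label `a⁻¹`, here `(a, false)`. -/
def Step (Γ : AGraph A V) (u : V) (x : A × Bool) (v : V) : Prop :=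
  (x.2 = true ∧ (u, x.1, v) ∈ Γ.edges) ∨ (x.2 = false ∧ (v, x.1, u) ∈ Γ.edges)

/-- The word `w` labels a path of `Γ` from `u` to `v`. -/
def Reads (Γ : AGraph A V) : V → List (A × Bool) → V → Prop
  | u, [], v => u = v
  | u, x :: w, v => ∃ t, Γ.Step u x t ∧ Γ.Reads t w v

/-- `(Γ, v)` is the Stallings graph (graphical representation) of the subgroup `H`: the pair is
admissible, and a reduced word represents an element of `H` if and only if it labels a loop
at `v` in `Γ`. -/
structure IsStallingsGraph (Γ : AGraph A V) (v : V) (H : Subgroup (FreeGroup A)) : Prop where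
  admissible : Γ.Admissible v
  mem_iff : ∀ w : List (A × Bool), FreeGroup.IsReduced w →
    (FreeGroup.mk w ∈ H ↔ Γ.Reads v w v)

/-- An admissible pair is the Stallings graph of at most one subgroup. -/
theorem IsStallingsGraph.subgroup_unique {Γ : AGraph A V} {v : V}
    {H K : Subgroup (FreeGroup A)} (hH : Γ.IsStallingsGraph v H)
    (hK : Γ.IsStallingsGraph v K) : H = K := by
  classical
  ext g
  have h1 := hH.mem_iff g.toWord FreeGroup.isReduced_toWord
  have h2 := hK.mem_iff g.toWord FreeGroup.isReduced_toWord
  rw [FreeGroup.mk_toWord] at h1 h2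
  exact h1.trans h2.symm

theorem edges_injective :
    Function.Injective (fun Γ : AGraph A V => Γ.edges) := by
  rintro ⟨E, h1, h2⟩ ⟨E', h1', h2'⟩ h
  simp only at h
  subst h
  rfl

end AGraph

/-- The size `n` subgroups of the free group on `A`: those whose Stallings graph has `n`
vertices (which we may take to be the elements of `Fin n`). Such subgroups are automatically
finitely generated. -/
def subgroupsOfSize (A : Type*) (n : ℕ) : Set (Subgroup (FreeGroup A)) :=
  {H | ∃ (Γ : AGraph A (Fin n)) (v : Fin n), Γ.IsStallingsGraph v H}

/-- There are finitely many subgroups of each size. -/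
theorem finite_subgroupsOfSize (A : Type*) [Finite A] (n : ℕ) :
    (subgroupsOfSize A n).Finite := by
  have : Finite (AGraph A (Fin n)) := Finite.of_injective _ AGraph.edges_injective
  have key : subgroupsOfSize A n =
      ⋃ p : AGraph A (Fin n) × Fin n, {H | p.1.IsStallingsGraph p.2 H} := by
    ext H
    simp [subgroupsOfSize]
  rw [key]
  refine Set.finite_iUnion fun p => Set.Subsingleton.finite ?_
  intro H hH K hK
  exact hH.subgroup_unique hK

/-- `H` intersects trivially the conjugacy classes of the generators: it contains no conjugate
of a letter. -/
def AvoidsGenerators {A : Type*} (H : Subgroup (FreeGroup A)) : Prop :=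
  ∀ a : A, Disjoint (H : Set (FreeGroup A)) (conjugatesOf (FreeGroup.of a))

/-- The probability that a uniformly distributed random size `n` subgroup of the free group
on `A` has the property `P`. -/
noncomputable def sizeProbability (A : Type*) (n : ℕ)
    (P : Subgroup (FreeGroup A) → Prop) : ℝ :=
  ({H | H ∈ subgroupsOfSize A n ∧ P H}.ncard : ℝ) / ((subgroupsOfSize A n).ncard : ℝ)

/-! An `A`-graph on `Fin n` is a family of r independent partial injections, one per letter. A
uniform partial injection of n points has no fixed point with probability tending to exp(-1), so a
random `A`-graph has no loop edge with probability tending to exp(-r). The work is to pass from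
these labelled graphs to subgroups.

Passing is possible because a uniform labelled graph is, with probability tending to 1, connected
and without leaves, hence admissible at every base vertex; conditioning on admissibility leaves the
limit unchanged (`tendsto_fraction_admissible_and`). Both facts use two letters. Everything rests on
the count n! * `coeff n` of partial injections of n points and on `coeff_succ_sub_le`, which says
that on average at most √n points lie outside the domain. It makes leaves rare, and it gives `coeff
(n - j) / coeff n` → 1, which turns inclusion-exclusion into the series of exp(-1).

Counting labelled pairs is counting subgroups because each subgroup of size n comes from exactly n!
pairs (`natCard_labellings`): Stallings graphs are unique up to isomorphism, and a pointed connected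
`A`-graph has no nontrivial automorphism. Uniqueness needs that in an admissible graph each reduced
word read from the base extends to a reduced loop (`exists_isReduced_reads`).

Finally, a loop labelled a at u, reached from the base along w, puts the conjugate of a by w in H;
conversely a conjugate in H, written without cancellation, must traverse such a loop
(`avoidsGenerators_iff`). -/

/-- A partial injection from `U` to `V`, as a functional and injective relation. -/
@[ext]
structure PartialInjection (U V : Type*) where
  rel : U → V → Prop
  det : ∀ u v v', rel u v → rel u v' → v = v'
  codet : ∀ u u' v, rel u v → rel u' v → u = u'

/-! ### Numbers of partial injections and growth of their coefficients -/

namespace PartialInjection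

variable {U V : Type*}

instance [Finite U] [Finite V] : Finite (PartialInjection U V) :=
  Finite.of_injective (fun f => f.rel) fun _ _ h => PartialInjection.ext h

instance : Nonempty (PartialInjection U V) :=
  ⟨⟨fun _ _ => False, fun _ _ _ h => h.elim, fun _ _ _ h => h.elim⟩⟩

/-- The partial injection with a given domain and given values. -/
def ofEmbedding (p : Σ s : Finset U, (s ↪ V)) : PartialInjection U V where
  rel u v := ∃ h : u ∈ p.1, p.2 ⟨u, h⟩ = v
  det := by rintro u v v' ⟨h, rfl⟩ ⟨h', rfl⟩; rfl
  codet := by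
    rintro u u' v ⟨h, rfl⟩ ⟨h', h2⟩
    exact (congrArg Subtype.val (p.2.injective h2)).symm

theorem ofEmbedding_bijective [Finite U] :
    Function.Bijective (ofEmbedding : (Σ s : Finset U, (s ↪ V)) → PartialInjection U V) := by
  classical
  have := Fintype.ofFinite U
  constructor
  · rintro ⟨s, e⟩ ⟨s', e'⟩ h
    have hrel : ∀ u v, (∃ h : u ∈ s, e ⟨u, h⟩ = v) ↔ ∃ h : u ∈ s', e' ⟨u, h⟩ = v := fun u v =>
      iff_of_eq (congrFun (congrFun (congrArg PartialInjection.rel h) u) v)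
    have hs : s = s' := by
      ext u
      constructor
      · intro hu
        obtain ⟨h', -⟩ := (hrel u _).1 ⟨hu, rfl⟩
        exact h'
      · intro hu
        obtain ⟨h', -⟩ := (hrel u _).2 ⟨hu, rfl⟩
        exact h'
    subst hs
    congr 1
    ext ⟨u, hu⟩
    obtain ⟨_, h'⟩ := (hrel u _).1 ⟨hu, rfl⟩
    exact h'.symm
  · intro f
    have hf : ∀ u : (Finset.univ.filter fun u => ∃ v, f.rel u v), ∃ v, f.rel u v := fun u =>
      (Finset.mem_filter.1 u.2).2
    choose e he using hf
    refine ⟨⟨_, ⟨e, fun u u' h => Subtype.ext (f.codet _ _ _ (he u) (h ▸ he u'))⟩⟩, ?_⟩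
    ext u v
    constructor
    · rintro ⟨h, rfl⟩
      exact he ⟨u, h⟩
    · intro h
      exact ⟨by simpa using ⟨v, h⟩, f.det _ _ _ (he ⟨u, _⟩) h⟩

/-- The number of partial injections from an `m`-element set to an `n`-element set. -/
def count (m n : ℕ) : ℕ := ∑ k ∈ Finset.range (m + 1), m.choose k * n.descFactorial k

theorem natCard [Finite U] [Finite V] :
    Nat.card (PartialInjection U V) = count (Nat.card U) (Nat.card V) := by
  classical
  have := Fintype.ofFinite U
  have := Fintype.ofFinite V
  rw [← Nat.card_congr (Equiv.ofBijective _ (ofEmbedding_bijective (U := U) (V := V)))]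
  rw [Nat.card_sigma]
  simp only [Nat.card_eq_fintype_card, Fintype.card_embedding_eq, Fintype.card_coe]
  rw [← Finset.powerset_univ, Finset.sum_powerset_apply_card
    (fun k => (Fintype.card V).descFactorial k)]
  simp [count]

/-- Exchanging source and target. -/
def symmEquiv : PartialInjection U V ≃ PartialInjection V U where
  toFun f := ⟨fun v u => f.rel u v, fun _ _ _ h h' => f.codet _ _ _ h h',
    fun _ _ _ h h' => f.det _ _ _ h h'⟩
  invFun f := ⟨fun v u => f.rel u v, fun _ _ _ h h' => f.codet _ _ _ h h',
    fun _ _ _ h h' => f.det _ _ _ h h'⟩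
  left_inv _ := rfl
  right_inv _ := rfl

/-- The `n`-th coefficient of the exponential generating series of partial injections. -/
noncomputable def coeff (n : ℕ) : ℝ :=
  ∑ m ∈ Finset.range (n + 1), (n.choose m : ℝ) / (m.factorial : ℝ)

theorem coeff_eq_sum {n N : ℕ} (h : n ≤ N) :
    coeff n = ∑ m ∈ Finset.range (N + 1), (n.choose m : ℝ) / (m.factorial : ℝ) := by
  refine Finset.sum_subset (by simpa using h) fun m _ hm => ?_
  rw [Nat.choose_eq_zero_of_lt (by simpa using hm)]
  simp

theorem coeff_pos (n : ℕ) : 0 < coeff n :=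
  Finset.sum_pos' (fun _ _ => by positivity) ⟨0, by simp, by simp⟩

theorem coeff_mono : Monotone coeff := by
  intro n N h
  rw [coeff_eq_sum h, coeff]
  gcongr

/-- In `coeff` the index m is the number of points outside the domain, so the sum over domain sizes
is reversed. -/
theorem cast_count_self (n : ℕ) : (count n n : ℝ) = n.factorial * coeff n := by
  rw [count, coeff, ← Finset.sum_range_reflect, Finset.mul_sum, Nat.add_sub_cancel]
  push_cast
  refine Finset.sum_congr rfl fun k hk => ?_
  have hk : k ≤ n := by simpa [Nat.lt_succ_iff] using hk
  rw [Nat.choose_symm hk]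
  have := Nat.factorial_mul_descFactorial (Nat.sub_le n k)
  rw [Nat.sub_sub_self hk] at this
  rw [← this]
  push_cast
  field_simp

theorem coeff_succ_sub (n : ℕ) : coeff (n + 1) - coeff n =
    ∑ j ∈ Finset.range (n + 1), (n.choose j : ℝ) / ((j + 1).factorial : ℝ) := by
  rw [coeff_eq_sum (Nat.le_succ n), coeff, ← Finset.sum_sub_distrib, Finset.sum_range_succ']
  simp [Nat.choose_succ_succ, add_div]

/-- These are the partial injections of n + 1 points whose domain avoids a given point. Pascal's
rule turns the sum into a difference of consecutive coefficients. -/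
theorem cast_count_succ (n : ℕ) :
    (count n (n + 1) : ℝ) = (n + 1).factorial * (coeff (n + 1) - coeff n) := by
  rw [coeff_succ_sub, count, ← Finset.sum_range_reflect, Finset.mul_sum, Nat.add_sub_cancel]
  push_cast
  refine Finset.sum_congr rfl fun k hk => ?_
  have hk : k ≤ n := by simpa [Nat.lt_succ_iff] using hk
  rw [Nat.choose_symm hk]
  have := Nat.factorial_mul_descFactorial (n := n + 1) (k := n - k) (by omega)
  rw [show n + 1 - (n - k) = k + 1 by omega] at this
  rw [← this]
  push_cast
  field_simp

/-- Give m the weight C(N, m)/m!, with N = n + 1. The mean of m is N times the relative increment of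
`coeff`, its second moment is at most N, and Cauchy-Schwarz bounds the mean by √N. -/
theorem coeff_succ_sub_le (n : ℕ) :
    coeff (n + 1) - coeff n ≤ coeff (n + 1) / √(n + 1 : ℝ) := by
  set N := n + 1 with hN
  set t : ℕ → ℝ := fun m => (N.choose m : ℝ) / (m.factorial : ℝ) with ht
  have ht0 : ∀ m, 0 ≤ t m := fun m => by simp only [ht]; positivity
  have hsum : coeff N = ∑ m ∈ Finset.range (N + 1), t m := rfl
  have hmean : (N : ℝ) * (coeff N - coeff n) = ∑ m ∈ Finset.range (N + 1), (m : ℝ) * t m := by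
    rw [coeff_succ_sub, Finset.sum_range_succ' _ N, Finset.mul_sum]
    simp only [Nat.cast_zero, zero_mul, add_zero]
    refine Finset.sum_congr rfl fun j _ => ?_
    have h : (N : ℝ) * n.choose j = N.choose (j + 1) * (j + 1) := by
      exact_mod_cast Nat.add_one_mul_choose_eq n j
    simp only [ht]
    rw [mul_div_assoc', h]
    push_cast
    ring
  -- An index shift: (j + 1)² t(j + 1) = (N - j) t(j) ≤ N t(j).
  have hsq : ∑ m ∈ Finset.range (N + 1), (m : ℝ) ^ 2 * t m ≤ N * coeff N := by
    rw [Finset.sum_range_succ', hsum, Finset.mul_sum, Finset.sum_range_succ _ N]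
    have h0 : ∑ j ∈ Finset.range N, ((j + 1 : ℕ) : ℝ) ^ 2 * t (j + 1) ≤
        ∑ j ∈ Finset.range N, (N : ℝ) * t j := by
      refine Finset.sum_le_sum fun j hj => ?_
      have hj : j ≤ N := (by simpa using hj : j < N).le
      have h : (N.choose (j + 1) : ℝ) * (j + 1) = N.choose j * (N - j) := by
        rw [← Nat.cast_sub hj]
        exact_mod_cast Nat.choose_succ_right_eq N j
      have : ((j + 1 : ℕ) : ℝ) ^ 2 * t (j + 1) = (N - j) * t j := by
        simp only [ht, Nat.factorial_succ]
        push_cast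
        field_simp
        linarith
      rw [this]
      have := ht0 j
      gcongr
      simp
    have h1 : 0 ≤ (N : ℝ) * t N := mul_nonneg (by positivity) (ht0 N)
    simpa using h0.trans (le_add_of_nonneg_right h1)
  have hcs : (∑ m ∈ Finset.range (N + 1), (m : ℝ) * t m) ^ 2 ≤
      (∑ m ∈ Finset.range (N + 1), (m : ℝ) ^ 2 * t m) * ∑ m ∈ Finset.range (N + 1), t m := by
    refine Finset.sum_sq_le_sum_mul_sum_of_sq_le_mul _ (fun m _ => ?_) (fun m _ => ht0 m)
      fun m _ => le_of_eq (by ring)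
    have := ht0 m
    positivity
  rw [← hmean, ← hsum] at hcs
  have hc := coeff_pos N
  have hNpos : (0 : ℝ) < N := by positivity
  have hle : ((N : ℝ) * (coeff N - coeff n)) ^ 2 ≤ (√N * coeff N) ^ 2 := by
    refine hcs.trans ((mul_le_mul_of_nonneg_right hsq hc.le).trans_eq ?_)
    rw [mul_pow, Real.sq_sqrt hNpos.le]
    ring
  have hle' := abs_le_of_sq_le_sq' hle (by positivity)
  have hsqrt : (0 : ℝ) < √N := Real.sqrt_pos.2 hNpos
  have hcast : ((n : ℝ) + 1) = N := by simp [hN]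
  rw [hcast, le_div_iff₀ hsqrt]
  have h2 : √(N : ℝ) * (√N * (coeff N - coeff n)) ≤ √N * coeff N := by
    rw [← mul_assoc, Real.mul_self_sqrt hNpos.le]
    exact hle'.2
  rw [mul_comm]
  exact le_of_mul_le_mul_left h2 hsqrt

/-- Bound 4^m/m! by exp 4 and use the binomial theorem. Any base below √2 would serve: its square
must be beaten by the 2^k of `two_pow_le_choose`. -/
theorem coeff_le (k : ℕ) : coeff k ≤ Real.exp 4 * (5 / 4) ^ k := by
  have h : ((5 : ℝ) / 4) ^ k = ∑ m ∈ Finset.range (k + 1), (1 / 4 : ℝ) ^ m * k.choose m := by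
    rw [show (5 / 4 : ℝ) = 1 / 4 + 1 by norm_num, add_pow]
    simp
  rw [h, coeff, Finset.mul_sum]
  refine Finset.sum_le_sum fun m _ => ?_
  have h1 := Real.pow_div_factorial_le_exp 4 (by norm_num) m
  have h2 : (k.choose m : ℝ) / m.factorial =
      (4 ^ m / m.factorial) * ((1 / 4 : ℝ) ^ m * k.choose m) := by
    rw [one_div, inv_pow]
    field_simp
  rw [h2]
  gcongr

theorem tendsto_coeff_ratio_succ :
    Filter.Tendsto (fun n => coeff n / coeff (n + 1)) Filter.atTop (nhds 1) := by
  have h0 : Filter.Tendsto (fun n : ℕ => 1 - 1 / √(n + 1 : ℝ)) Filter.atTop (nhds (1 - 0)) := by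
    refine tendsto_const_nhds.sub ?_
    simp only [one_div]
    refine tendsto_inv_atTop_zero.comp (Real.tendsto_sqrt_atTop.comp ?_)
    exact Filter.tendsto_atTop_add_const_right _ _ tendsto_natCast_atTop_atTop
  rw [sub_zero] at h0
  refine tendsto_of_tendsto_of_tendsto_of_le_of_le h0 tendsto_const_nhds (fun n => ?_) fun n => ?_
  · have := coeff_succ_sub_le n
    have hc := coeff_pos (n + 1)
    rw [le_div_iff₀ hc, sub_mul, one_mul, one_div_mul_eq_div]
    linarith
  · exact div_le_one_of_le₀ (coeff_mono (Nat.le_succ n)) (coeff_pos _).le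

theorem tendsto_coeff_ratio (j : ℕ) :
    Filter.Tendsto (fun n => coeff (n - j) / coeff n) Filter.atTop (nhds 1) := by
  -- Shifting n by j removes the truncated subtraction; the ratio then telescopes.
  rw [← Filter.tendsto_add_atTop_iff_nat j]
  simp only [Nat.add_sub_cancel]
  induction j with
  | zero => simp [div_self (coeff_pos _).ne']
  | succ j ih =>
    have h := ih.mul (tendsto_coeff_ratio_succ.comp (Filter.tendsto_add_atTop_nat j))
    rw [one_mul] at h
    refine h.congr fun n => ?_
    simp only [Function.comp, ← add_assoc]
    rw [div_mul_div_cancel₀ (coeff_pos _).ne']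

end PartialInjection

/-! ### Partial injections under constraints, and their proportions -/

namespace PartialInjection

variable {U V : Type*}

/-- Partial injections with domain in `s` and range in `t`. -/
def restrictEquiv (s : Set U) (t : Set V) :
    {f : PartialInjection U V // ∀ u v, f.rel u v → u ∈ s ∧ v ∈ t} ≃ PartialInjection s t where
  toFun f := ⟨fun u v => f.1.rel u v, fun _ _ _ h h' => Subtype.ext (f.1.det _ _ _ h h'),
    fun _ _ _ h h' => Subtype.ext (f.1.codet _ _ _ h h')⟩
  invFun g := ⟨⟨fun u v => ∃ (hu : u ∈ s) (hv : v ∈ t), g.rel ⟨u, hu⟩ ⟨v, hv⟩,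
      fun _ _ _ ⟨_, _, h⟩ ⟨_, _, h'⟩ => congrArg Subtype.val (g.det _ _ _ h h'),
      fun _ _ _ ⟨_, _, h⟩ ⟨_, _, h'⟩ => congrArg Subtype.val (g.codet _ _ _ h h')⟩,
    fun _ _ ⟨hu, hv, _⟩ => ⟨hu, hv⟩⟩
  left_inv f := by
    ext u v
    exact ⟨fun ⟨_, _, h⟩ => h, fun h => ⟨(f.2 _ _ h).1, (f.2 _ _ h).2, h⟩⟩
  right_inv g := by
    ext u v
    exact ⟨fun ⟨_, _, h⟩ => h, fun h => ⟨u.2, v.2, h⟩⟩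

/-- Partial injections of `V` fixing every element of `t`. -/
def fixEquiv (t : Set V) :
    {f : PartialInjection V V // ∀ u ∈ t, f.rel u u} ≃
      PartialInjection (tᶜ : Set V) (tᶜ : Set V) where
  toFun f := ⟨fun u v => f.1.rel u v, fun _ _ _ h h' => Subtype.ext (f.1.det _ _ _ h h'),
    fun _ _ _ h h' => Subtype.ext (f.1.codet _ _ _ h h')⟩
  invFun g := ⟨⟨fun u v => (u ∈ t ∧ u = v) ∨
        ∃ (hu : u ∈ tᶜ) (hv : v ∈ tᶜ), g.rel ⟨u, hu⟩ ⟨v, hv⟩, by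
      rintro u v v' (⟨hu, rfl⟩ | ⟨hu, hv, h⟩) (⟨hu', rfl⟩ | ⟨hu', hv', h'⟩)
      exacts [rfl, absurd hu hu', absurd hu' hu, congrArg Subtype.val (g.det _ _ _ h h')], by
      rintro u u' v (⟨hu, rfl⟩ | ⟨hu, hv, h⟩) (⟨hu', rfl⟩ | ⟨hu', hv', h'⟩)
      exacts [rfl, absurd hu hv', absurd hu' hv, congrArg Subtype.val (g.codet _ _ _ h h')]⟩,
    fun u hu => Or.inl ⟨hu, rfl⟩⟩
  left_inv f := by
    ext u v
    constructor
    · rintro (⟨hu, rfl⟩ | ⟨_, _, h⟩)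
      exacts [f.2 u hu, h]
    · intro h
      by_cases hu : u ∈ t
      · exact Or.inl ⟨hu, f.1.det _ _ _ (f.2 u hu) h⟩
      · refine Or.inr ⟨hu, fun hv => hu ?_, h⟩
        rwa [f.1.codet _ _ _ h (f.2 v hv)]
  right_inv g := by
    ext u v
    constructor
    · rintro (⟨hu, _⟩ | ⟨_, _, h⟩)
      exacts [absurd hu u.2, h]
    · exact fun h => Or.inr ⟨u.2, v.2, h⟩

theorem natCard_fix [Finite V] (t : Set V) :
    Nat.card {f : PartialInjection V V // ∀ u ∈ t, f.rel u u} =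
      count (Nat.card V - t.ncard) (Nat.card V - t.ncard) := by
  rw [Nat.card_congr (fixEquiv t), natCard, Nat.card_coe_set_eq, Set.ncard_compl]

/-- Such a map is determined by its restrictions to `s` and to the complement. An upper bound is all
that connectedness requires. -/
theorem natCard_respecting_le [Finite V] (s : Set V) :
    Nat.card {f : PartialInjection V V // ∀ u v, f.rel u v → (u ∈ s ↔ v ∈ s)} ≤
      count s.ncard s.ncard * count (Nat.card V - s.ncard) (Nat.card V - s.ncard) := by
  have h : Function.Injective
      (fun f : {f : PartialInjection V V // ∀ u v, f.rel u v → (u ∈ s ↔ v ∈ s)} =>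
        ((⟨fun u v => f.1.rel u v, fun _ _ _ h h' => Subtype.ext (f.1.det _ _ _ h h'),
          fun _ _ _ h h' => Subtype.ext (f.1.codet _ _ _ h h')⟩,
          ⟨fun u v => f.1.rel u v, fun _ _ _ h h' => Subtype.ext (f.1.det _ _ _ h h'),
          fun _ _ _ h h' => Subtype.ext (f.1.codet _ _ _ h h')⟩) :
        PartialInjection s s × PartialInjection (sᶜ : Set V) (sᶜ : Set V))) := by
    intro f g hfg
    have h1 : ∀ u v : s, f.1.rel u v ↔ g.1.rel u v := fun u v => iff_of_eq
      (congrFun (congrFun (congrArg rel (congrArg Prod.fst hfg)) u) v)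
    have h2 : ∀ u v : (sᶜ : Set V), f.1.rel u v ↔ g.1.rel u v := fun u v => iff_of_eq
      (congrFun (congrFun (congrArg rel (congrArg Prod.snd hfg)) u) v)
    ext u v
    by_cases huv : u ∈ s ↔ v ∈ s
    · by_cases hu : u ∈ s
      · exact h1 ⟨u, hu⟩ ⟨v, huv.1 hu⟩
      · exact h2 ⟨u, hu⟩ ⟨v, fun hv => hu (huv.2 hv)⟩
    · exact ⟨fun h => absurd (f.2 _ _ h) huv, fun h => absurd (g.2 _ _ h) huv⟩
  refine (Nat.card_le_card_of_injective _ h).trans_eq ?_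
  rw [Nat.card_prod, natCard, natCard, Nat.card_coe_set_eq, Nat.card_coe_set_eq, Set.ncard_compl]

theorem natCard_not_mem_dom [Finite V] (w : V) :
    Nat.card {f : PartialInjection V V // ∀ v, ¬ f.rel w v} =
      count (Nat.card V - 1) (Nat.card V) := by
  rw [Nat.card_congr (Equiv.subtypeEquivRight (q := fun f : PartialInjection V V =>
    ∀ u v, f.rel u v → u ∈ ({w}ᶜ : Set V) ∧ v ∈ (Set.univ : Set V)) fun f => ?_),
    Nat.card_congr (restrictEquiv _ _), natCard, Nat.card_coe_set_eq, Nat.card_coe_set_eq,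
    Set.ncard_compl, Set.ncard_singleton, Set.ncard_univ]
  exact ⟨fun h u v huv => ⟨fun hu => h v (hu ▸ huv), trivial⟩, fun h v hv => (h w v hv).1 rfl⟩

theorem natCard_not_mem_range [Finite V] (w : V) :
    Nat.card {f : PartialInjection V V // ∀ u, ¬ f.rel u w} =
      count (Nat.card V - 1) (Nat.card V) := by
  rw [← natCard_not_mem_dom w]
  exact Nat.card_congr (symmEquiv.subtypeEquiv fun f => Iff.rfl)

theorem natCard_not_mem_dom_range [Finite V] (w : V) :
    Nat.card {f : PartialInjection V V // (∀ v, ¬ f.rel w v) ∧ ∀ u, ¬ f.rel u w} =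
      count (Nat.card V - 1) (Nat.card V - 1) := by
  rw [Nat.card_congr (Equiv.subtypeEquivRight (q := fun f : PartialInjection V V =>
    ∀ u v, f.rel u v → u ∈ ({w}ᶜ : Set V) ∧ v ∈ ({w}ᶜ : Set V)) fun f => ?_),
    Nat.card_congr (restrictEquiv _ _), natCard, Nat.card_coe_set_eq,
    Set.ncard_compl, Set.ncard_singleton]
  exact ⟨fun h u v huv => ⟨fun hu => h.1 v (hu ▸ huv), fun hv => h.2 u (hv ▸ huv)⟩,
    fun h => ⟨fun v hv => (h w v hv).1 rfl, fun u hu => (h u w hu).2 rfl⟩⟩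

/-- Inclusion-exclusion over the set of points required to be fixed; the remaining points carry an
arbitrary partial injection. -/
theorem natCard_fixedPointFree (V : Type*) [Finite V] :
    (Nat.card {f : PartialInjection V V // ∀ u, ¬ f.rel u u} : ℤ) =
      ∑ j ∈ Finset.range (Nat.card V + 1), (-1) ^ j * (Nat.card V).choose j *
        (count (Nat.card V - j) (Nat.card V - j) : ℤ) := by
  classical
  have := Fintype.ofFinite V
  have := Fintype.ofFinite (PartialInjection V V)
  have h := Finset.inclusion_exclusion_card_inf_compl (Finset.univ : Finset V)
    (fun u => Finset.univ.filter fun f : PartialInjection V V => f.rel u u)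
  have h1 : ∀ t : Finset V,
      (t.inf fun u => Finset.univ.filter fun f : PartialInjection V V => f.rel u u).card =
        count (Nat.card V - t.card) (Nat.card V - t.card) := fun t => by
    rw [← Set.ncard_coe_finset t, ← natCard_fix, Nat.card_eq_fintype_card, Fintype.card_subtype]
    congr 1
    ext f
    simp [Finset.mem_inf]
  have h2 : Finset.univ.inf (fun u : V => (Finset.univ.filter fun f : PartialInjection V V =>
      f.rel u u)ᶜ) = Finset.univ.filter fun f : PartialInjection V V => ∀ u, ¬ f.rel u u := by
    ext f
    simp [Finset.mem_inf]
  simp only [h1] at h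
  rw [h2, Finset.sum_powerset_apply_card (fun k => (-1 : ℤ) ^ k *
    (count (Nat.card V - k) (Nat.card V - k) : ℤ))] at h
  rw [Nat.card_eq_fintype_card, Fintype.card_subtype, h, Finset.card_univ, Nat.card_eq_fintype_card]
  refine Finset.sum_congr rfl fun j _ => ?_
  rw [nsmul_eq_mul]
  ring

theorem count_div_le_inv (n : ℕ) (hn : n ≠ 0) :
    (count (n - 1) (n - 1) : ℝ) / count n n ≤ 1 / n := by
  obtain ⟨n, rfl⟩ := Nat.exists_eq_succ_of_ne_zero hn
  simp only [Nat.succ_eq_add_one, Nat.add_sub_cancel]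
  rw [cast_count_self, cast_count_self, Nat.factorial_succ]
  have h1 := coeff_pos (n + 1)
  have h2 := coeff_mono (Nat.le_succ n)
  have h3 : (0 : ℝ) < n.factorial := by positivity
  rw [div_le_div_iff₀ (by positivity) (by positivity)]
  push_cast
  have : 0 ≤ (n.factorial : ℝ) * (n + 1) * (coeff (n + 1) - coeff n) :=
    mul_nonneg (by positivity) (sub_nonneg.2 h2)
  linarith

theorem count_div_le_inv_sqrt (n : ℕ) (hn : n ≠ 0) :
    (count (n - 1) n : ℝ) / count n n ≤ 1 / √n := by
  obtain ⟨n, rfl⟩ := Nat.exists_eq_succ_of_ne_zero hn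
  simp only [Nat.succ_eq_add_one, Nat.add_sub_cancel]
  rw [cast_count_succ, cast_count_self, mul_div_mul_left _ _ (by positivity),
    div_le_iff₀ (coeff_pos _), one_div_mul_eq_div]
  simpa using coeff_succ_sub_le n

/-- The factorials give the binomial coefficient exactly, and `coeff (n - k) / coeff n` is at most
1. -/
theorem count_mul_count_div_le {n k : ℕ} (hk : k ≤ n) :
    (count k k * count (n - k) (n - k) : ℝ) / count n n ≤ coeff k / n.choose k := by
  have hc : (0 : ℝ) < n.choose k := by exact_mod_cast Nat.choose_pos hk
  rw [cast_count_self, cast_count_self, cast_count_self, ← Nat.choose_mul_factorial_mul_factorial hk]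
  have h1 := coeff_pos n
  have h2 := coeff_mono (Nat.sub_le n k)
  have h3 := coeff_pos k
  push_cast
  rw [div_le_div_iff₀ (by positivity) (by positivity)]
  have : 0 ≤ (n.choose k : ℝ) * k.factorial * (n - k).factorial * coeff k *
    (coeff n - coeff (n - k)) := mul_nonneg (by positivity) (sub_nonneg.2 h2)
  linarith

/-- After division by n! * `coeff n`, the j-th inclusion-exclusion term is (-1)^j/j! times `coeff (n
- j) / coeff n`. That ratio tends to 1 and never exceeds 1, so dominated convergence applies with
bound 1/j!. -/
theorem tendsto_fixedPointFree_ratio :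
    Filter.Tendsto (fun n => (Nat.card {f : PartialInjection (Fin n) (Fin n) // ∀ u, ¬ f.rel u u} : ℝ)
      / count n n) Filter.atTop (nhds (Real.exp (-1))) := by
  have hsum : HasSum (fun j : ℕ => (-1 : ℝ) ^ j / j.factorial) (Real.exp (-1)) := by
    rw [Real.exp_eq_exp_ℝ]
    exact NormedSpace.expSeries_div_hasSum_exp (-1 : ℝ)
  have habs : Summable fun j : ℕ => (1 : ℝ) / j.factorial := by
    simpa using Real.summable_pow_div_factorial 1
  have hlim := tendsto_tsum_of_dominated_convergence (𝓕 := Filter.atTop)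
    (f := fun n j : ℕ => if j ≤ n then (-1 : ℝ) ^ j / j.factorial * (coeff (n - j) / coeff n) else 0)
    (g := fun j => (-1 : ℝ) ^ j / j.factorial) (bound := fun j => 1 / j.factorial) habs
    (fun j => ?_) (Filter.Eventually.of_forall fun n j => ?_)
  · rw [hsum.tsum_eq] at hlim
    refine hlim.congr fun n => ?_
    rw [tsum_eq_sum (s := Finset.range (n + 1)) fun j hj => if_neg (by simpa using hj)]
    have h := natCard_fixedPointFree (Fin n)
    rw [Nat.card_fin] at h
    have h' := congrArg (Int.cast : ℤ → ℝ) h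
    push_cast at h'
    rw [h', Finset.sum_div]
    refine Finset.sum_congr rfl fun j hj => ?_
    have hj : j ≤ n := by simpa [Nat.lt_succ_iff] using hj
    rw [if_pos hj, cast_count_self, cast_count_self, ← Nat.choose_mul_factorial_mul_factorial hj]
    have := (coeff_pos n).ne'
    have : (n.choose j : ℝ) ≠ 0 := by exact_mod_cast (Nat.choose_pos hj).ne'
    push_cast
    field_simp
  · have h := (tendsto_coeff_ratio j).const_mul ((-1 : ℝ) ^ j / j.factorial)
    rw [mul_one] at h
    refine h.congr' ?_
    filter_upwards [Filter.eventually_ge_atTop j] with n hn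
    rw [if_pos hn]
  · split_ifs
    · rw [norm_mul, norm_div, norm_pow, norm_neg, norm_one, one_pow, Real.norm_natCast,
        Real.norm_of_nonneg (div_nonneg (coeff_pos _).le (coeff_pos _).le)]
      exact mul_le_of_le_one_right (by positivity)
        (div_le_one_of_le₀ (coeff_mono (Nat.sub_le n j)) (coeff_pos _).le)
    · rw [norm_zero]
      positivity

end PartialInjection

/-! ### Proportions in finite types -/

/-- The proportion of elements of a finite type which satisfy a predicate. -/
noncomputable def fraction {X : Type*} (p : X → Prop) : ℝ :=
  (Nat.card {x // p x} : ℝ) / (Nat.card X : ℝ)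

section Fraction

variable {X Y : Type*}

theorem fraction_nonneg (p : X → Prop) : 0 ≤ fraction p := by
  unfold fraction; positivity

theorem fraction_mono [Finite X] {p q : X → Prop} (h : ∀ x, p x → q x) :
    fraction p ≤ fraction q := by
  unfold fraction
  gcongr
  exact Nat.card_le_card_of_injective _ (Subtype.impEmbedding p q h).injective

theorem fraction_true [Finite X] [Nonempty X] : fraction (fun _ : X => True) = 1 := by
  rw [fraction, Nat.card_congr (Equiv.subtypeUnivEquiv fun _ => trivial)]
  exact div_self (by exact_mod_cast Nat.card_pos.ne')

theorem fraction_le_one [Finite X] (p : X → Prop) : fraction p ≤ 1 :=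
  div_le_one_of_le₀ (by exact_mod_cast Finite.card_subtype_le p) (by positivity)

theorem fraction_false {p : X → Prop} (h : ∀ x, ¬ p x) : fraction p = 0 := by
  have : IsEmpty {x // p x} := ⟨fun x => h _ x.2⟩
  simp [fraction]

theorem fraction_or_le [Finite X] (p q : X → Prop) :
    fraction (fun x => p x ∨ q x) ≤ fraction p + fraction q := by
  unfold fraction
  rw [← add_div]
  gcongr
  have h := Set.ncard_union_le {x | p x} {x | q x}
  rw [← Nat.card_coe_set_eq, ← Nat.card_coe_set_eq, ← Nat.card_coe_set_eq] at h
  exact_mod_cast h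

theorem fraction_exists_le [Finite X] {ι : Type*} [Fintype ι] (p : ι → X → Prop) :
    fraction (fun x => ∃ i, p i x) ≤ ∑ i, fraction (p i) := by
  have key : ∀ s : Finset ι,
      fraction (fun x => ∃ i ∈ s, p i x) ≤ ∑ i ∈ s, fraction (p i) := fun s => by
    classical
    induction s using Finset.induction_on with
    | empty => exact (fraction_false (by simp)).le
    | insert a s ha ih =>
      rw [Finset.sum_insert ha]
      refine (fraction_mono fun x hx => ?_).trans ((fraction_or_le _ _).trans
        (add_le_add_right ih _))
      simpa using hx
  simpa using key Finset.univ

theorem fraction_congr (e : X ≃ Y) {p : X → Prop} {q : Y → Prop} (h : ∀ x, p x ↔ q (e x)) :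
    fraction p = fraction q := by
  rw [fraction, fraction, Nat.card_congr e, Nat.card_congr (e.subtypeEquiv h)]

theorem fraction_pi {ι : Type*} [Fintype ι] (p : ι → X → Prop) :
    fraction (fun f : ι → X => ∀ i, p i (f i)) = ∏ i, fraction (p i) := by
  unfold fraction
  rw [Nat.card_congr (Equiv.subtypePiEquivPi (p := fun i => p i)), Nat.card_pi, Nat.card_pi,
    Finset.prod_div_distrib]
  push_cast
  rfl

theorem fraction_pi_pair [Finite X] [Nonempty X] {ι : Type*} [Fintype ι] {i j : ι} (hij : i ≠ j)
    (p q : X → Prop) :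
    fraction (fun f : ι → X => p (f i) ∧ q (f j)) = fraction p * fraction q := by
  -- The conditions are vacuous at coordinates other than i and j, whose factors are therefore 1.
  have h := fraction_pi (X := X) (fun k x => (k = i → p x) ∧ (k = j → q x))
  rw [Finset.prod_eq_mul i j hij (fun k _ hk => ?_) (by simp) (by simp)] at h
  · convert h using 2
    · ext f
      exact ⟨fun h k => ⟨fun hk => hk ▸ h.1, fun hk => hk ▸ h.2⟩,
        fun h => ⟨(h i).1 rfl, (h j).2 rfl⟩⟩
    · simp [hij]
    · simp [hij.symm]
  · simp [hk.1, hk.2, fraction_true]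

end Fraction

/-! ### Random labelled graphs: leaves, connectedness, loops -/

namespace AGraph

variable {A V : Type*}

/-- An `A`-graph is a family of partial injections indexed by the letters. -/
def equivPi (A V : Type*) : AGraph A V ≃ (A → PartialInjection V V) where
  toFun Γ a := ⟨fun u v => (u, a, v) ∈ Γ.edges, fun u v v' => Γ.det u a v v',
    fun u u' v => Γ.codet u u' a v⟩
  invFun f := ⟨{e | (f e.2.1).rel e.1 e.2.2}, fun u a v v' => (f a).det u v v',
    fun u u' a v => (f a).codet u u' v⟩
  left_inv _ := rfl
  right_inv _ := rfl

instance [Finite A] [Finite V] : Finite (AGraph A V) :=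
  Finite.of_injective _ edges_injective

theorem fraction_forall_letter [Fintype A] [Finite V] (p : (V → V → Prop) → Prop) :
    fraction (fun Γ : AGraph A V => ∀ a, p fun u v => (u, a, v) ∈ Γ.edges) =
      fraction (fun f : PartialInjection V V => p f.rel) ^ Fintype.card A := by
  refine (fraction_congr (equivPi A V) (q := fun f => ∀ a, p (f a).rel) fun Γ => Iff.rfl).trans ?_
  rw [fraction_pi fun _ (f : PartialInjection V V) => p f.rel]
  simp

theorem fraction_two_letters [Fintype A] [Finite V] {a b : A} (hab : a ≠ b)
    (p q : (V → V → Prop) → Prop) :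
    fraction (fun Γ : AGraph A V =>
      p (fun u v => (u, a, v) ∈ Γ.edges) ∧ q fun u v => (u, b, v) ∈ Γ.edges) =
      fraction (fun f : PartialInjection V V => p f.rel) *
        fraction (fun f : PartialInjection V V => q f.rel) := by
  exact (fraction_congr (equivPi A V) (q := fun f => p (f a).rel ∧ q (f b).rel)
    fun Γ => Iff.rfl).trans (fraction_pi_pair hab (fun f : PartialInjection V V => p f.rel)
      (fun f : PartialInjection V V => q f.rel))

theorem not_isLeaf_of_two_occurrences {Γ : AGraph A V} {w : V} {s t : Set (V × A × V)}
    (hs : ∀ e ∈ s, e ∈ Γ.edges ∧ e.1 = w) (ht : ∀ e ∈ t, e ∈ Γ.edges ∧ e.2.2 = w)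
    (h : 2 ≤ s.encard + t.encard) : ¬ Γ.IsLeaf w := by
  intro hw
  have h1 : s.encard + t.encard ≤ 1 :=
    (add_le_add (Set.encard_le_encard hs) (Set.encard_le_encard ht)).trans hw
  exact absurd (h.trans h1) (by norm_num)

theorem two_le_encard_of_ne {X : Type*} {s : Set X} {x y : X} (h : x ≠ y) (hx : x ∈ s)
    (hy : y ∈ s) : 2 ≤ s.encard :=
  (Set.encard_pair h).symm.le.trans (Set.encard_le_encard (Set.pair_subset hx hy))

/-- A leaf misses three of the four half-edges belonging to two given letters. -/
theorem IsLeaf.missing {Γ : AGraph A V} {w : V} (h : Γ.IsLeaf w) {a b : A} (hab : a ≠ b) :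
    ((((∀ v, (w, a, v) ∉ Γ.edges) ∧ ∀ u, (u, a, w) ∉ Γ.edges) ∧ ∀ v, (w, b, v) ∉ Γ.edges) ∨
      (((∀ v, (w, a, v) ∉ Γ.edges) ∧ ∀ u, (u, a, w) ∉ Γ.edges) ∧ ∀ u, (u, b, w) ∉ Γ.edges)) ∨
    ((((∀ v, (w, b, v) ∉ Γ.edges) ∧ ∀ u, (u, b, w) ∉ Γ.edges) ∧ ∀ v, (w, a, v) ∉ Γ.edges) ∨
      (((∀ v, (w, b, v) ∉ Γ.edges) ∧ ∀ u, (u, b, w) ∉ Γ.edges) ∧ ∀ u, (u, a, w) ∉ Γ.edges)) := by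
  have hout : ∀ e f, e ≠ f → e ∈ Γ.edges → f ∈ Γ.edges → e.1 = w → f.1 = w → False :=
    fun e f hef he hf hew hfw => not_isLeaf_of_two_occurrences (Γ := Γ) (w := w)
      (s := {e | e ∈ Γ.edges ∧ e.1 = w}) (t := ∅) (fun _ h => h) (by simp)
      (by rw [Set.encard_empty, add_zero]; exact two_le_encard_of_ne hef ⟨he, hew⟩ ⟨hf, hfw⟩) h
  have hin : ∀ e f, e ≠ f → e ∈ Γ.edges → f ∈ Γ.edges → e.2.2 = w → f.2.2 = w → False :=
    fun e f hef he hf hew hfw => not_isLeaf_of_two_occurrences (Γ := Γ) (w := w)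
      (s := ∅) (t := {e | e ∈ Γ.edges ∧ e.2.2 = w}) (by simp) (fun _ h => h)
      (by rw [Set.encard_empty, zero_add]; exact two_le_encard_of_ne hef ⟨he, hew⟩ ⟨hf, hfw⟩) h
  have hio : ∀ e f, e ∈ Γ.edges → f ∈ Γ.edges → e.1 = w → f.2.2 = w → False :=
    fun e f he hf hew hfw => not_isLeaf_of_two_occurrences (Γ := Γ) (w := w)
      (s := {e}) (t := {f}) (by rintro _ rfl; exact ⟨he, hew⟩) (by rintro _ rfl; exact ⟨hf, hfw⟩)
      (by simp [one_add_one_eq_two]) h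
  have hoo : (∀ v, (w, a, v) ∉ Γ.edges) ∨ ∀ v, (w, b, v) ∉ Γ.edges := by
    by_contra! hc
    obtain ⟨⟨v, hv⟩, u, hu⟩ := hc
    exact hout _ _ (fun h => hab (congrArg (fun e => e.2.1) h)) hv hu rfl rfl
  have hii : (∀ v, (v, a, w) ∉ Γ.edges) ∨ ∀ v, (v, b, w) ∉ Γ.edges := by
    by_contra! hc
    obtain ⟨⟨v, hv⟩, u, hu⟩ := hc
    exact hin _ _ (fun h => hab (congrArg (fun e => e.2.1) h)) hv hu rfl rfl
  have hoi : ∀ c d, (∀ v, (w, c, v) ∉ Γ.edges) ∨ ∀ v, (v, d, w) ∉ Γ.edges := by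
    by_contra! hc
    obtain ⟨c, d, ⟨v, hv⟩, u, hu⟩ := hc
    exact hio _ _ hv hu rfl rfl
  have h1 := hoi a a
  have h2 := hoi a b
  have h3 := hoi b a
  have h4 := hoi b b
  tauto

/-- In each of the four cases one letter misses both half-edges at `w` (probability at most 1/n) and
an independent letter misses one (at most 1/√n). The product stays small after summing over the n
vertices. -/
theorem fraction_isLeaf_le [Fintype A] (hr : 2 ≤ Fintype.card A) {n : ℕ} (hn : n ≠ 0)
    (w : Fin n) : fraction (fun Γ : AGraph A (Fin n) => Γ.IsLeaf w) ≤ 4 * (1 / n * (1 / √n)) := by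
  obtain ⟨a, b, hab⟩ := Fintype.exists_pair_of_one_lt_card hr
  have hboth : fraction (fun f : PartialInjection (Fin n) (Fin n) =>
      (∀ v, ¬ f.rel w v) ∧ ∀ u, ¬ f.rel u w) ≤ 1 / n := by
    rw [fraction, PartialInjection.natCard_not_mem_dom_range, PartialInjection.natCard, Nat.card_fin]
    exact PartialInjection.count_div_le_inv n hn
  have hdom : fraction (fun f : PartialInjection (Fin n) (Fin n) => ∀ v, ¬ f.rel w v) ≤ 1 / √n := by
    rw [fraction, PartialInjection.natCard_not_mem_dom, PartialInjection.natCard, Nat.card_fin]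
    exact PartialInjection.count_div_le_inv_sqrt n hn
  have hran : fraction (fun f : PartialInjection (Fin n) (Fin n) => ∀ u, ¬ f.rel u w) ≤ 1 / √n := by
    rw [fraction, PartialInjection.natCard_not_mem_range, PartialInjection.natCard, Nat.card_fin]
    exact PartialInjection.count_div_le_inv_sqrt n hn
  have hodom : ∀ {c d : A}, c ≠ d → fraction (fun Γ : AGraph A (Fin n) =>
      ((∀ v, (w, c, v) ∉ Γ.edges) ∧ ∀ u, (u, c, w) ∉ Γ.edges) ∧ ∀ v, (w, d, v) ∉ Γ.edges) ≤
        1 / n * (1 / √n) := fun {c d} hcd => by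
    rw [fraction_two_letters hcd (fun R => (∀ v, ¬ R w v) ∧ ∀ u, ¬ R u w) (fun R => ∀ v, ¬ R w v)]
    exact mul_le_mul hboth hdom (fraction_nonneg _) (by positivity)
  have horan : ∀ {c d : A}, c ≠ d → fraction (fun Γ : AGraph A (Fin n) =>
      ((∀ v, (w, c, v) ∉ Γ.edges) ∧ ∀ u, (u, c, w) ∉ Γ.edges) ∧ ∀ u, (u, d, w) ∉ Γ.edges) ≤
        1 / n * (1 / √n) := fun {c d} hcd => by
    rw [fraction_two_letters hcd (fun R => (∀ v, ¬ R w v) ∧ ∀ u, ¬ R u w) (fun R => ∀ u, ¬ R u w)]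
    exact mul_le_mul hboth hran (fraction_nonneg _) (by positivity)
  refine (fraction_mono fun Γ h => h.missing hab).trans ((fraction_or_le _ _).trans
    ((add_le_add ((fraction_or_le _ _).trans (add_le_add (hodom hab) (horan hab)))
      ((fraction_or_le _ _).trans (add_le_add (hodom hab.symm) (horan hab.symm)))).trans_eq ?_))
  ring

theorem fraction_exists_isLeaf_le [Fintype A] (hr : 2 ≤ Fintype.card A) {n : ℕ} (hn : n ≠ 0) :
    fraction (fun Γ : AGraph A (Fin n) => ∃ w, Γ.IsLeaf w) ≤ 4 * (1 / √n) := by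
  refine (fraction_exists_le _).trans
    ((Finset.sum_le_sum fun w _ => fraction_isLeaf_le hr hn w).trans_eq ?_)
  have : (n : ℝ) ≠ 0 := by exact_mod_cast hn
  simp only [Finset.sum_const, Finset.card_univ, Fintype.card_fin, nsmul_eq_mul]
  field_simp

theorem exists_invariant_of_not_connected [Fintype V] [Nonempty V] {Γ : AGraph A V}
    (h : ¬ Γ.underlying.Connected) : ∃ S : Finset V, (1 ≤ S.card ∧ 2 * S.card ≤ Fintype.card V) ∧
      ∀ a u v, (u, a, v) ∈ Γ.edges → (u ∈ S ↔ v ∈ S) := by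
  classical
  rw [SimpleGraph.connected_iff] at h
  have h' : ¬ Γ.underlying.Preconnected := fun hc => h ⟨hc, inferInstance⟩
  simp only [SimpleGraph.Preconnected, not_forall] at h'
  obtain ⟨x, y, hxy⟩ := h'
  set S : Finset V := Finset.univ.filter fun u => Γ.underlying.Reachable x u with hS
  have hinv : ∀ a u v, (u, a, v) ∈ Γ.edges → (u ∈ S ↔ v ∈ S) := by
    intro a u v he
    by_cases huv : u = v
    · rw [huv]
    · have hadj : Γ.underlying.Adj u v :=
        (SimpleGraph.fromRel_adj _ _ _).2 ⟨huv, Or.inl ⟨a, he⟩⟩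
      simp only [hS, Finset.mem_filter, Finset.mem_univ, true_and]
      exact ⟨fun h => h.trans hadj.reachable, fun h => h.trans hadj.symm.reachable⟩
  have hx : x ∈ S := by simp [hS]
  have hy : y ∈ Sᶜ := by simp [hS, hxy]
  have hcard := Finset.card_add_card_compl S
  -- Either the component of x or its complement contains at most half of the vertices.
  by_cases hle : 2 * S.card ≤ Fintype.card V
  · exact ⟨S, ⟨Finset.card_pos.2 ⟨x, hx⟩, hle⟩, hinv⟩
  · refine ⟨Sᶜ, ⟨Finset.card_pos.2 ⟨y, hy⟩, by omega⟩, fun a u v he => ?_⟩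
    rw [Finset.mem_compl, Finset.mem_compl, hinv a u v he]

theorem fraction_invariant_le [Fintype A] (hr : 2 ≤ Fintype.card A) {n : ℕ}
    (S : Finset (Fin n)) :
    fraction (fun Γ : AGraph A (Fin n) => ∀ a u v, (u, a, v) ∈ Γ.edges → (u ∈ S ↔ v ∈ S)) ≤
      (PartialInjection.coeff S.card / n.choose S.card) ^ 2 := by
  rw [fraction_forall_letter fun R => ∀ u v, R u v → (u ∈ S ↔ v ∈ S)]
  -- Two letters suffice: each further factor is at most 1.
  refine (pow_le_pow_of_le_one (fraction_nonneg _) (fraction_le_one _) hr).trans ?_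
  refine pow_le_pow_left₀ (fraction_nonneg _) ?_ 2
  have hS : S.card ≤ n := by simpa using S.card_le_univ
  refine le_trans ?_ (PartialInjection.count_mul_count_div_le hS)
  rw [fraction, PartialInjection.natCard, Nat.card_fin]
  gcongr
  have h := PartialInjection.natCard_respecting_le (S : Set (Fin n))
  rw [Set.ncard_coe_finset, Nat.card_fin] at h
  exact_mod_cast h

/-- Union bound over invariant sets of size k: there are C(n, k) of them, each with probability at
most (`coeff k` / C(n, k))², so one binomial coefficient survives in the denominator. -/
theorem fraction_not_connected_le [Fintype A] (hr : 2 ≤ Fintype.card A) {n : ℕ} (hn : n ≠ 0) :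
    fraction (fun Γ : AGraph A (Fin n) => ¬ Γ.underlying.Connected) ≤
      ∑ k ∈ Finset.range (n + 1), if 1 ≤ k ∧ 2 * k ≤ n then
        PartialInjection.coeff k ^ 2 / n.choose k else 0 := by
  have : Nonempty (Fin n) := ⟨⟨0, Nat.pos_of_ne_zero hn⟩⟩
  refine (fraction_mono fun Γ h => exists_invariant_of_not_connected h).trans
    ((fraction_exists_le _).trans ?_)
  have hle : ∀ S : Finset (Fin n), fraction (fun Γ : AGraph A (Fin n) =>
      (1 ≤ S.card ∧ 2 * S.card ≤ Fintype.card (Fin n)) ∧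
        ∀ a u v, (u, a, v) ∈ Γ.edges → (u ∈ S ↔ v ∈ S)) ≤
      if 1 ≤ S.card ∧ 2 * S.card ≤ n then
        (PartialInjection.coeff S.card / n.choose S.card) ^ 2 else 0 := by
    intro S
    split_ifs with h
    · exact (fraction_mono fun Γ h => h.2).trans (fraction_invariant_le hr S)
    · exact (fraction_false fun Γ h' => h (by simpa using h'.1)).le
  refine (Finset.sum_le_sum fun S _ => hle S).trans_eq ?_
  rw [← Finset.powerset_univ, Finset.sum_powerset_apply_card (fun k => if 1 ≤ k ∧ 2 * k ≤ n then
        (PartialInjection.coeff k / n.choose k) ^ 2 else 0), Finset.card_univ, Fintype.card_fin]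
  refine Finset.sum_congr rfl fun k hk => ?_
  have hk : k ≤ n := by simpa [Nat.lt_succ_iff] using hk
  have : (n.choose k : ℝ) ≠ 0 := by exact_mod_cast (Nat.choose_pos hk).ne'
  split_ifs
  · rw [nsmul_eq_mul]
    field_simp
  · simp

/-- C(n, k) is at least the central binomial coefficient C(2k, k), which at least doubles at each
step. -/
theorem two_pow_le_choose {n k : ℕ} (h : 2 * k ≤ n) : 2 ^ k ≤ n.choose k := by
  refine le_trans ?_ (Nat.choose_le_choose k h)
  rw [← Nat.centralBinom_eq_two_mul_choose]
  clear h
  induction k with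
  | zero => simp
  | succ k ih =>
    have := Nat.succ_mul_centralBinom_succ k
    rw [pow_succ]
    nlinarith

theorem le_choose {n k : ℕ} (hk : 1 ≤ k) (h : 2 * k ≤ n) : n ≤ n.choose k := by
  induction k, hk using Nat.le_induction with
  | base => simp
  | succ k _ ih => exact (ih (by omega)).trans (Nat.choose_le_succ_of_lt_half_left (by omega))

theorem tendsto_fraction_not_connected [Fintype A] (hr : 2 ≤ Fintype.card A) :
    Filter.Tendsto (fun n => fraction (fun Γ : AGraph A (Fin n) => ¬ Γ.underlying.Connected))
      Filter.atTop (nhds 0) := by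
  -- Each term tends to 0 because C(n, k) ≥ n. The dominating ratio is 25/32 = (5/4)²/2, from
  -- `coeff_le` and `two_pow_le_choose`.
  have hlim := tendsto_tsum_of_dominated_convergence (𝓕 := Filter.atTop)
    (f := fun n k : ℕ => if 1 ≤ k ∧ 2 * k ≤ n then
        PartialInjection.coeff k ^ 2 / n.choose k else 0)
    (g := fun _ => (0 : ℝ)) (bound := fun k => Real.exp 4 ^ 2 * (25 / 32) ^ k)
    ((summable_geometric_of_lt_one (by norm_num) (by norm_num)).mul_left _)
    (fun k => ?_) (Filter.Eventually.of_forall fun n k => ?_)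
  · rw [tsum_zero] at hlim
    refine tendsto_of_tendsto_of_tendsto_of_le_of_le' tendsto_const_nhds hlim
      (Filter.Eventually.of_forall fun n => fraction_nonneg _) ?_
    filter_upwards [Filter.eventually_ne_atTop 0] with n hn
    refine (fraction_not_connected_le hr hn).trans_eq
      (tsum_eq_sum (s := Finset.range (n + 1)) fun j hj => if_neg fun h => ?_).symm
    simp only [Finset.mem_range, not_lt] at hj
    omega
  · have h0 : Filter.Tendsto (fun n : ℕ => PartialInjection.coeff k ^ 2 / (n : ℝ)) Filter.atTop
        (nhds 0) := tendsto_const_div_atTop_nhds_zero_nat _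
    refine tendsto_of_tendsto_of_tendsto_of_le_of_le' tendsto_const_nhds h0
      (Filter.Eventually.of_forall fun n => ?_) ?_
    · split_ifs <;> positivity
    · filter_upwards [Filter.eventually_gt_atTop 0] with n hn
      have hn' : (0 : ℝ) < n := by exact_mod_cast hn
      split_ifs with h
      · gcongr
        exact_mod_cast le_choose h.1 h.2
      · positivity
  · split_ifs with h
    · rw [Real.norm_of_nonneg (by positivity)]
      have h1 : ((2 : ℝ) ^ k) ≤ n.choose k := by exact_mod_cast two_pow_le_choose h.2
      have h2 := PartialInjection.coeff_le k
      have h3 := (PartialInjection.coeff_pos k).le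
      calc PartialInjection.coeff k ^ 2 / n.choose k
          ≤ (Real.exp 4 * (5 / 4) ^ k) ^ 2 / 2 ^ k := by gcongr
        _ = Real.exp 4 ^ 2 * (25 / 32) ^ k := by
          rw [mul_pow, ← pow_mul, mul_comm k 2, pow_mul, mul_div_assoc, ← div_pow]
          norm_num
    · rw [norm_zero]
      positivity

theorem tendsto_fraction_bad [Fintype A] (hr : 2 ≤ Fintype.card A) :
    Filter.Tendsto (fun n => fraction (fun Γ : AGraph A (Fin n) =>
      ¬ (Γ.underlying.Connected ∧ ∀ w, ¬ Γ.IsLeaf w))) Filter.atTop (nhds 0) := by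
  have h1 : Filter.Tendsto (fun n : ℕ => 4 * (1 / √(n : ℝ))) Filter.atTop (nhds (4 * 0)) := by
    refine Filter.Tendsto.const_mul _ ?_
    simp only [one_div]
    exact tendsto_inv_atTop_zero.comp (Real.tendsto_sqrt_atTop.comp tendsto_natCast_atTop_atTop)
  have h2 := (tendsto_fraction_not_connected hr).add h1
  rw [mul_zero, add_zero] at h2
  refine tendsto_of_tendsto_of_tendsto_of_le_of_le' tendsto_const_nhds h2
    (Filter.Eventually.of_forall fun n => fraction_nonneg _) ?_
  filter_upwards [Filter.eventually_ne_atTop 0] with n hn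
  refine (fraction_mono fun Γ h => ?_).trans ((fraction_or_le _ _).trans
    (add_le_add_right (fraction_exists_isLeaf_le hr hn) _))
  rw [not_and_or] at h
  simpa using h

theorem tendsto_fraction_loopless [Fintype A] :
    Filter.Tendsto (fun n => fraction (fun Γ : AGraph A (Fin n) => ∀ a u, (u, a, u) ∉ Γ.edges))
      Filter.atTop (nhds (Real.exp (-(Fintype.card A : ℝ)))) := by
  have h := PartialInjection.tendsto_fixedPointFree_ratio.pow (Fintype.card A)
  rw [← Real.exp_nat_mul, mul_neg, mul_one] at h
  refine h.congr fun n => ?_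
  rw [fraction_forall_letter fun R => ∀ u, ¬ R u u, fraction, PartialInjection.natCard, Nat.card_fin]

end AGraph

/-! ### Reading words in an `A`-graph -/

namespace AGraph

variable {A V V' : Type*} {Γ : AGraph A V} {Γ' : AGraph A V'}

section Reading

theorem Step.det {u v v' : V} {x : A × Bool} (h : Γ.Step u x v) (h' : Γ.Step u x v') : v = v' := by
  rcases h with ⟨h1, h2⟩ | ⟨h1, h2⟩ <;> rcases h' with ⟨h1', h2'⟩ | ⟨h1', h2'⟩
  · exact Γ.det _ _ _ _ h2 h2'
  · simp_all
  · simp_all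
  · exact Γ.codet _ _ _ _ h2 h2'

theorem step_inv {u v : V} {x : A × Bool} : Γ.Step v (x.1, !x.2) u ↔ Γ.Step u x v := by
  obtain ⟨a, b⟩ := x
  cases b <;> simp [Step]

theorem reads_nil {u v : V} : Γ.Reads u [] v ↔ u = v := Iff.rfl

theorem reads_cons {u v : V} {x : A × Bool} {w : List (A × Bool)} :
    Γ.Reads u (x :: w) v ↔ ∃ t, Γ.Step u x t ∧ Γ.Reads t w v := Iff.rfl

theorem reads_singleton {u v : V} {x : A × Bool} : Γ.Reads u [x] v ↔ Γ.Step u x v := by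
  simp [reads_cons, reads_nil]

theorem reads_append {w w' : List (A × Bool)} {u v : V} :
    Γ.Reads u (w ++ w') v ↔ ∃ t, Γ.Reads u w t ∧ Γ.Reads t w' v := by
  induction w generalizing u with
  | nil => simp [reads_nil]
  | cons x w ih =>
    simp only [List.cons_append, reads_cons, ih]
    exact ⟨fun ⟨t, h, s, h', h''⟩ => ⟨s, ⟨t, h, h'⟩, h''⟩,
      fun ⟨s, ⟨t, h, h'⟩, h''⟩ => ⟨t, h, s, h', h''⟩⟩

theorem Reads.det {w : List (A × Bool)} {u v v' : V} (h : Γ.Reads u w v) (h' : Γ.Reads u w v') :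
    v = v' := by
  induction w generalizing u with
  | nil => exact h.symm.trans h'
  | cons x w ih =>
    obtain ⟨t, ht, h⟩ := h
    obtain ⟨t', ht', h'⟩ := h'
    obtain rfl := ht.det ht'
    exact ih h h'

theorem Reads.invRev {w : List (A × Bool)} {u v : V} (h : Γ.Reads u w v) :
    Γ.Reads v (FreeGroup.invRev w) u := by
  induction w generalizing u with
  | nil => exact h.symm
  | cons x w ih =>
    obtain ⟨t, ht, h⟩ := h
    rw [FreeGroup.invRev_cons, reads_append]
    exact ⟨t, ih h, reads_singleton.2 (step_inv.2 ht)⟩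

/-- Determinism forces a path reading a letter and then its inverse to return to its start, so the
pair can be deleted. The converse fails: an inserted pair need not be readable. -/
theorem Reads.of_red {w w' : List (A × Bool)} {u v : V} (h : FreeGroup.Red w w')
    (hw : Γ.Reads u w v) : Γ.Reads u w' v := by
  induction h with
  | refl => exact hw
  | tail _ hs ih =>
    obtain @⟨l₁, l₂, a, b⟩ := hs
    obtain ⟨t, h1, s, h2, s', h3, h4⟩ := reads_append.1 ih
    obtain rfl : s' = t := h3.det (x := (a, !b)) (step_inv.2 h2)
    exact reads_append.2 ⟨_, h1, h4⟩

theorem Reads.of_mk_eq {w w' : List (A × Bool)} {u v : V}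
    (h : FreeGroup.mk w = FreeGroup.mk w') (hw' : FreeGroup.IsReduced w')
    (hw : Γ.Reads u w v) : Γ.Reads u w' v := by
  classical
  have h1 : FreeGroup.reduce w = w' := (FreeGroup.reduce.sound h).trans hw'.reduce_eq
  exact h1 ▸ hw.of_red FreeGroup.reduce.red

theorem exists_isReduced (g : FreeGroup A) :
    ∃ w, FreeGroup.IsReduced w ∧ FreeGroup.mk w = g := by
  classical
  exact ⟨g.toWord, FreeGroup.isReduced_toWord, FreeGroup.mk_toWord⟩

theorem Reads.exists_isReduced {w : List (A × Bool)} {u v : V} (h : Γ.Reads u w v) :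
    ∃ w', FreeGroup.IsReduced w' ∧ Γ.Reads u w' v := by
  obtain ⟨w', h1, h2⟩ := AGraph.exists_isReduced (FreeGroup.mk w)
  exact ⟨w', h1, h.of_mk_eq h2.symm h1⟩

theorem exists_reads (h : Γ.underlying.Connected) (u v : V) :
    ∃ w, FreeGroup.IsReduced w ∧ Γ.Reads u w v := by
  suffices ∃ w, Γ.Reads u w v from this.elim fun _ h => h.exists_isReduced
  obtain ⟨p⟩ := h.preconnected u v
  induction p with
  | nil => exact ⟨[], rfl⟩
  | cons hadj _ ih =>
    obtain ⟨w, hw⟩ := ih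
    obtain ⟨-, ⟨a, ha⟩ | ⟨a, ha⟩⟩ := (SimpleGraph.fromRel_adj _ _ _).1 hadj
    · exact ⟨(a, true) :: w, _, Or.inl ⟨rfl, ha⟩, hw⟩
    · exact ⟨(a, false) :: w, _, Or.inr ⟨rfl, ha⟩, hw⟩

/-- The subgroup of the elements whose reduced words label loops at `v`. -/
def loopSubgroup (Γ : AGraph A V) (v : V) : Subgroup (FreeGroup A) where
  carrier := {g | ∀ w, FreeGroup.IsReduced w → FreeGroup.mk w = g → Γ.Reads v w v}
  one_mem' w hw h := Reads.of_mk_eq (w := []) h.symm hw rfl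
  mul_mem' {g h} hg hh w hw hgh := by
    obtain ⟨w₁, hw₁, rfl⟩ := exists_isReduced g
    obtain ⟨w₂, hw₂, rfl⟩ := exists_isReduced h
    rw [FreeGroup.mul_mk] at hgh
    exact (reads_append.2 ⟨v, hg w₁ hw₁ rfl, hh w₂ hw₂ rfl⟩).of_mk_eq hgh.symm hw
  inv_mem' {g} hg w hw h := by
    obtain ⟨w₁, hw₁, rfl⟩ := exists_isReduced g
    rw [FreeGroup.inv_mk] at h
    exact (hg w₁ hw₁ rfl).invRev.of_mk_eq h.symm hw

theorem Admissible.isStallingsGraph {v : V} (h : Γ.Admissible v) :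
    Γ.IsStallingsGraph v (Γ.loopSubgroup v) := by
  refine ⟨h, fun w hw => ⟨fun hm => hm w hw rfl, fun hr w' hw' heq => ?_⟩⟩
  exact hr.of_mk_eq heq.symm hw'

theorem IsStallingsGraph.mk_mem {v : V} {H : Subgroup (FreeGroup A)} (h : Γ.IsStallingsGraph v H)
    {w : List (A × Bool)} (hw : Γ.Reads v w v) : FreeGroup.mk w ∈ H := by
  obtain ⟨w', h1, h2⟩ := exists_isReduced (FreeGroup.mk w)
  exact h2 ▸ (h.mem_iff w' h1).2 (hw.of_mk_eq h2.symm h1)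

theorem IsStallingsGraph.reads_of_mk_mem {v : V} {H : Subgroup (FreeGroup A)}
    (h : Γ.IsStallingsGraph v H) {w : List (A × Bool)} (hw : FreeGroup.IsReduced w)
    (hm : FreeGroup.mk w ∈ H) : Γ.Reads v w v :=
  (h.mem_iff w hw).1 hm

end Reading

/-! ### Conjugates of letters and loop edges -/

section Avoiding

theorem IsStallingsGraph.avoidsGenerators_iff {v : V} {H : Subgroup (FreeGroup A)}
    (h : Γ.IsStallingsGraph v H) :
    AvoidsGenerators H ↔ ∀ (a : A) (u : V), (u, a, u) ∉ Γ.edges := by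
  constructor
  · intro hH a u hu
    obtain ⟨w, -, hw⟩ := exists_reads h.admissible.connected v u
    have hr : Γ.Reads v (w ++ [(a, true)] ++ FreeGroup.invRev w) v :=
      reads_append.2 ⟨u, reads_append.2 ⟨u, hw, reads_singleton.2 (Or.inl ⟨rfl, hu⟩)⟩, hw.invRev⟩
    refine Set.disjoint_left.1 (hH a) (h.mk_mem hr) ?_
    refine isConj_iff.2 ?_
    exact ⟨FreeGroup.mk w, by rw [FreeGroup.of, FreeGroup.inv_mk, FreeGroup.mul_mk, FreeGroup.mul_mk]⟩
  · intro hloop a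
    rw [Set.disjoint_left]
    intro g hg hconj
    obtain ⟨c, rfl⟩ := isConj_iff.1 hconj
    clear hconj
    obtain ⟨w, hw, rfl⟩ := exists_isReduced c
    induction w using List.reverseRecOn with
    | nil =>
      have hr : Γ.Reads v [(a, true)] v := by
        refine h.reads_of_mk_mem FreeGroup.IsReduced.singleton ?_
        rw [← FreeGroup.one_eq_mk] at hg
        simpa [FreeGroup.of] using hg
      obtain ⟨-, h1⟩ | ⟨h1, -⟩ := reads_singleton.1 hr
      · exact hloop _ _ h1
      · simp at h1
    | append_singleton w x ih =>
      -- A final letter a or a⁻¹ of the conjugator commutes with a and can be dropped.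
      by_cases hx : x.1 = a
      · refine ih (hw.infix (List.prefix_append _ _).isInfix) ?_
        convert hg using 1
        rw [← FreeGroup.mul_mk]
        have hcomm : FreeGroup.mk [x] * FreeGroup.of a * (FreeGroup.mk [x])⁻¹ = FreeGroup.of a := by
          obtain ⟨b, c⟩ := x
          obtain rfl : b = a := hx
          cases c
          · have : FreeGroup.mk [(b, false)] = (FreeGroup.of b)⁻¹ := rfl
            rw [this]; group
          · change FreeGroup.of b * FreeGroup.of b * (FreeGroup.of b)⁻¹ = _
            group
        nth_rewrite 1 [← hcomm]
        group
      -- Otherwise nothing cancels on either side of the central a. The reduced word is then a loop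
      -- at the base, and by determinism its initial and final segments meet at one vertex, where a
      -- labels a loop.
      · have hred : FreeGroup.IsReduced
            ((w ++ [x]) ++ [(a, true)] ++ FreeGroup.invRev (w ++ [x])) := by
          have h1 : FreeGroup.IsReduced ((w ++ [x]) ++ [(a, true)]) := by
            refine List.IsChain.append hw FreeGroup.IsReduced.singleton ?_
            simp [hx]
          have h2 : FreeGroup.IsReduced (FreeGroup.invRev (w ++ [x])) := by
            classical
            exact FreeGroup.IsReduced.of_reduce_eq
              (FreeGroup.reduce_invRev.trans (congrArg _ hw.reduce_eq))
          refine h1.append_overlap ?_ (by simp)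
          refine List.IsChain.append FreeGroup.IsReduced.singleton h2 ?_
          simp [FreeGroup.invRev, Ne.symm hx]
        rw [FreeGroup.of, FreeGroup.inv_mk, FreeGroup.mul_mk, FreeGroup.mul_mk] at hg
        obtain ⟨t, h1, h2⟩ := reads_append.1 (h.reads_of_mk_mem hred hg)
        obtain ⟨s, h3, h4⟩ := reads_append.1 h1
        have h5 := h2.invRev
        rw [FreeGroup.invRev_invRev] at h5
        obtain rfl := h3.det h5
        obtain ⟨-, h1⟩ | ⟨h1, -⟩ := reads_singleton.1 h4
        · exact hloop _ _ h1
        · simp at h1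

end Avoiding

/-! ### Non-backtracking continuation to the base vertex -/

section Trim

/-- Occurrences of `t` in the edges correspond to steps leaving `t`, a loop giving two of each. A
unique step would make `t` a leaf. -/
theorem exists_ne_step_of_not_isLeaf {t s : V} {y : A × Bool} (ht : ¬ Γ.IsLeaf t)
    (hy : Γ.Step t y s) : ∃ z r, z ≠ y ∧ Γ.Step t z r := by
  by_contra! hc
  apply ht
  obtain ⟨a, b⟩ := y
  have hsub : ∀ c d, (c, d) ≠ (a, b) → ∀ r, ¬ Γ.Step t (c, d) r := fun c d hcd r => hc _ r hcd
  unfold IsLeaf degree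
  cases b with
  | true =>
    have h1 : {e | e ∈ Γ.edges ∧ e.1 = t}.encard ≤ 1 := by
      rw [Set.encard_le_one_iff]
      rintro ⟨u, c, r⟩ ⟨u', c', r'⟩ ⟨he, rfl⟩ ⟨he', hu⟩
      obtain rfl : u' = u := hu
      have hc1 : c = a := by
        by_contra hne
        exact hsub c true (by simp [hne]) r (Or.inl ⟨rfl, he⟩)
      have hc2 : c' = a := by
        by_contra hne
        exact hsub c' true (by simp [hne]) r' (Or.inl ⟨rfl, he'⟩)
      subst hc1 hc2
      rw [Γ.det _ _ _ _ he he']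
    have h2 : {e | e ∈ Γ.edges ∧ e.2.2 = t} = ∅ := by
      ext ⟨u, c, r⟩
      simp only [Set.mem_ofPred_eq, Set.mem_empty_iff_false, iff_false]
      rintro ⟨he, rfl⟩
      exact hsub c false (by simp) u (Or.inr ⟨rfl, he⟩)
    rw [h2, Set.encard_empty, add_zero]
    exact h1
  | false =>
    have h1 : {e | e ∈ Γ.edges ∧ e.2.2 = t}.encard ≤ 1 := by
      rw [Set.encard_le_one_iff]
      rintro ⟨u, c, r⟩ ⟨u', c', r'⟩ ⟨he, rfl⟩ ⟨he', hu⟩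
      obtain rfl : r' = r := hu
      have hc1 : c = a := by
        by_contra hne
        exact hsub c false (by simp [hne]) u (Or.inr ⟨rfl, he⟩)
      have hc2 : c' = a := by
        by_contra hne
        exact hsub c' false (by simp [hne]) u' (Or.inr ⟨rfl, he'⟩)
      subst hc1 hc2
      rw [Γ.codet _ _ _ _ he he']
    have h2 : {e | e ∈ Γ.edges ∧ e.1 = t} = ∅ := by
      ext ⟨u, c, r⟩
      simp only [Set.mem_ofPred_eq, Set.mem_empty_iff_false, iff_false]
      rintro ⟨he, rfl⟩
      exact hsub c true (by simp) r (Or.inl ⟨rfl, he⟩)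
    rw [h2, Set.encard_empty, zero_add]
    exact h1

/-- In an admissible graph every edge can be continued to a path to the base vertex
without backtracking. -/
theorem Admissible.exists_isReduced_reads [Finite A] {v : V} (h : Γ.Admissible v) {u t : V}
    {x : A × Bool} (hx : Γ.Step u x t) :
    ∃ w, FreeGroup.IsReduced (x :: w) ∧ Γ.Reads t w v := by
  classical
  have := h.finite
  have := Fintype.ofFinite V
  have := Fintype.ofFinite A
  set inv : A × Bool → A × Bool := fun x => (x.1, !x.2) with hinv
  have hinvinv : ∀ x, inv (inv x) = x := fun x => by simp [hinv]
  have hstep : ∀ {p q y}, Γ.Step p y q → Γ.Step q (inv y) p := fun h => step_inv.2 h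
  -- `N` is the set of dead steps, those with no reduced continuation to `v`; `I` below consists of
  -- their reversals, recorded at the vertex where the dead step arrives.
  set N : Finset (V × (A × Bool)) := Finset.univ.filter fun s =>
    ∃ t, Γ.Step s.1 s.2 t ∧ ¬ ∃ w, FreeGroup.IsReduced (s.2 :: w) ∧ Γ.Reads t w v with hN
  set I : Finset (V × (A × Bool)) := Finset.univ.filter fun s =>
    ∃ r, Γ.Step s.1 s.2 r ∧ (r, inv s.2) ∈ N with hI
  have hNI : ∀ {p q y}, Γ.Step p y q → (p, y) ∈ N → (q, inv y) ∈ I := fun {p q y} hs hn => by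
    simp only [hI, Finset.mem_filter, Finset.mem_univ, true_and]
    exact ⟨p, hstep hs, (hinvinv y).symm ▸ hn⟩
  -- No dead step arrives at `v`, since the empty continuation would do.
  have hbase : ∀ {y}, (v, y) ∉ I := fun {y} hy => by
    simp only [hI, hN, Finset.mem_filter, Finset.mem_univ, true_and] at hy
    obtain ⟨r, hr, q, hq, hno⟩ := hy
    obtain rfl : q = v := hq.det (hstep hr)
    exact hno ⟨[], FreeGroup.IsReduced.singleton, rfl⟩
  -- If a dead step arrives at p, every step out of p other than its reversal is dead too.
  have hforward : ∀ {p y z r}, (p, y) ∈ I → z ≠ y → Γ.Step p z r → (p, z) ∈ N := by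
    intro p y z r hy hzy hr
    simp only [hI, hN, Finset.mem_filter, Finset.mem_univ, true_and] at hy ⊢
    obtain ⟨q, hq, p', hp', hno⟩ := hy
    obtain rfl : p' = p := hp'.det (hstep hq)
    refine ⟨r, hr, fun ⟨w, hw, hrw⟩ => hno ⟨z :: w, ?_, r, hr, hrw⟩⟩
    refine List.isChain_cons_cons.2 ⟨fun h1 => ?_, hw⟩
    by_contra h2
    refine hzy (Prod.ext h1.symm ?_)
    simp only [hinv] at h2
    cases hz : z.2 <;> cases hyb : y.2 <;> simp_all
  have hcard : N.card = I.card := by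
    -- Makes the target a total function; its value where no step exists is irrelevant.
    have htarget : ∀ s : V × (A × Bool), ∃ r, ∀ r', Γ.Step s.1 s.2 r' → r' = r := fun s => by
      by_cases hs : ∃ r, Γ.Step s.1 s.2 r
      · obtain ⟨r, hr⟩ := hs
        exact ⟨r, fun r' hr' => hr'.det hr⟩
      · exact ⟨s.1, fun r' hr' => absurd ⟨r', hr'⟩ hs⟩
    choose f hf using htarget
    have hff : ∀ s r, Γ.Step s.1 s.2 r → (f (f s, inv s.2), inv (inv s.2)) = s := by
      intro s r hr
      obtain rfl := hf s r hr
      rw [hinvinv, ← hf (f s, inv s.2) s.1 (hstep hr)]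
    refine Finset.card_nbij' (fun s => (f s, inv s.2)) (fun s => (f s, inv s.2)) ?_ ?_ ?_ ?_
    · intro s hs
      obtain ⟨-, r, hr, -⟩ := Finset.mem_filter.1 hs
      obtain rfl := hf s r hr
      exact hNI hr hs
    · intro s hs
      obtain ⟨-, r, hr, hrN⟩ := Finset.mem_filter.1 hs
      obtain rfl := hf s r hr
      exact hrN
    · intro s hs
      obtain ⟨-, r, hr, -⟩ := Finset.mem_filter.1 hs
      exact hff s r hr
    · intro s hs
      obtain ⟨-, r, hr, -⟩ := Finset.mem_filter.1 hs
      exact hff s r hr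
  -- At each vertex at most as many dead steps arrive as leave: two arrivals make every outgoing
  -- step dead, and a single one leaves another dead step because the vertex is not a leaf.
  have hle : ∀ p ∈ (Finset.univ : Finset V), (I.filter fun s => s.1 = p).card ≤
      (N.filter fun s => s.1 = p).card := by
    intro p _
    by_cases hex : ∃ y, (p, y) ∈ I
    · obtain ⟨y, hy⟩ := hex
      have hp : p ≠ v := by rintro rfl; exact hbase hy
      by_cases hex' : ∃ y', y' ≠ y ∧ (p, y') ∈ I
      · obtain ⟨y', hne, hy'⟩ := hex'
        refine Finset.card_le_card fun s hs => ?_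
        obtain ⟨q, z⟩ := s
        obtain ⟨hsI, rfl : q = p⟩ := Finset.mem_filter.1 hs
        refine Finset.mem_filter.2 ⟨?_, rfl⟩
        obtain ⟨-, r, hr, -⟩ := Finset.mem_filter.1 hsI
        by_cases hz : z = y
        · exact hforward hy' (hz ▸ hne.symm) hr
        · exact hforward hy hz hr
      · obtain ⟨-, r, hr, -⟩ := Finset.mem_filter.1 hy
        obtain ⟨z, r', hz, hr'⟩ := exists_ne_step_of_not_isLeaf (h.trim p hp) hr
        have h1 : (I.filter fun s => s.1 = p).card ≤ 1 := by
          refine (Finset.card_le_card (t := {(p, y)}) fun s hs => ?_).trans_eq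
            (Finset.card_singleton _)
          obtain ⟨q, z⟩ := s
          obtain ⟨hsI, rfl : q = p⟩ := Finset.mem_filter.1 hs
          by_contra hne
          exact hex' ⟨z, fun hz => hne (by simp [hz]), hsI⟩
        exact h1.trans (Finset.card_pos.2 ⟨(p, z), Finset.mem_filter.2 ⟨hforward hy hz hr', rfl⟩⟩)
    · rw [Finset.card_eq_zero.2]
      · exact Nat.zero_le _
      · refine Finset.filter_eq_empty_iff.2 ?_
        rintro ⟨q, z⟩ hs rfl
        exact hex ⟨z, hs⟩
  have hsumI := Finset.card_eq_sum_card_fiberwise (f := Prod.fst) (s := I)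
    (t := (Finset.univ : Finset V)) fun _ _ => Finset.mem_univ _
  have hsumN := Finset.card_eq_sum_card_fiberwise (f := Prod.fst) (s := N)
    (t := (Finset.univ : Finset V)) fun _ _ => Finset.mem_univ _
  -- Reversal gives equal totals, so the inequality is an equality at every vertex.
  have heq := (Finset.sum_eq_sum_iff_of_le hle).1 (by rw [← hsumI, ← hsumN, hcard])
  by_contra hno
  have hxN : (u, x) ∈ N := by
    simp only [hN, Finset.mem_filter, Finset.mem_univ, true_and]
    exact ⟨t, hx, hno⟩
  -- If no dead step arrived at p, none would leave it by `heq`. The reversed step from q to p would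
  -- then be dead by `hforward`, yet it arrives at p. Connectedness now carries dead arrivals to
  -- `v`, against `hbase`.
  have hclosed : ∀ {p y q}, Γ.Step p y q → (∃ z, (q, z) ∈ I) → ∃ z, (p, z) ∈ I := by
    rintro p y q hs ⟨z, hz⟩
    by_contra hp
    have hpN : (p, y) ∉ N := fun hpN => by
      have h0 : (I.filter fun s => s.1 = p).card = 0 := by
        refine Finset.card_eq_zero.2 (Finset.filter_eq_empty_iff.2 ?_)
        rintro ⟨q', z'⟩ hz' rfl
        exact hp ⟨z', hz'⟩
      rw [heq p (Finset.mem_univ _), Finset.card_eq_zero] at h0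
      exact Finset.filter_eq_empty_iff.1 h0 hpN rfl
    have hyI : (q, inv y) ∉ I := fun hyI => by
      obtain ⟨-, r, hr, hrN⟩ := Finset.mem_filter.1 hyI
      obtain rfl := hr.det (hstep hs)
      exact hpN (hinvinv y ▸ hrN)
    have hqN : (q, inv y) ∈ N := hforward hz (fun h => hyI (h ▸ hz)) (hstep hs)
    exact hp ⟨_, hNI (hstep hs) hqN⟩
  have hreads : ∀ w p, Γ.Reads p w t → ∃ z, (p, z) ∈ I := by
    intro w
    induction w with
    | nil => rintro p rfl; exact ⟨_, hNI hx hxN⟩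
    | cons y w ih =>
      rintro p ⟨q, hq, hw⟩
      exact hclosed hq (ih q hw)
  obtain ⟨w, -, hw⟩ := exists_reads h.connected v t
  obtain ⟨z, hz⟩ := hreads w v hw
  exact hbase hz

end Trim

end AGraph

/-! ### Uniqueness of the Stallings graph -/

namespace AGraph

variable {A V V' : Type*} {Γ : AGraph A V} {Γ' : AGraph A V'}

section Uniqueness

theorem Admissible.exists_loop_extending [Finite A] {v u : V} (h : Γ.Admissible v)
    {w : List (A × Bool)} (hw : FreeGroup.IsReduced w) (hr : Γ.Reads v w u) :
    ∃ s, FreeGroup.IsReduced (w ++ s) ∧ Γ.Reads v (w ++ s) v := by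
  rcases List.eq_nil_or_concat' w with rfl | ⟨w, x, rfl⟩
  · exact ⟨[], FreeGroup.IsReduced.nil, rfl⟩
  · obtain ⟨t, ht, hx⟩ := reads_append.1 hr
    obtain ⟨s, hs, hsv⟩ := h.exists_isReduced_reads (reads_singleton.1 hx)
    exact ⟨s, FreeGroup.IsReduced.append_overlap hw hs (by simp), reads_append.2 ⟨u, hr, hsv⟩⟩

variable {v : V} {v' : V'} {H : Subgroup (FreeGroup A)}

theorem IsStallingsGraph.exists_reads [Finite A] (h : Γ.IsStallingsGraph v H)
    (h' : Γ'.IsStallingsGraph v' H) {w : List (A × Bool)} (hw : FreeGroup.IsReduced w) {u : V}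
    (hr : Γ.Reads v w u) : ∃ u', Γ'.Reads v' w u' := by
  obtain ⟨s, hs, hsv⟩ := h.admissible.exists_loop_extending hw hr
  obtain ⟨u', hu', -⟩ := reads_append.1 (h'.reads_of_mk_mem hs (h.mk_mem hsv))
  exact ⟨u', hu'⟩

/-- The product of w₁ with the inverse of w₂ lies in H, so its reduced form is a loop at `v'`.
Following it by w₂ gives a path that freely reduces to w₁, and determinism identifies the endpoints.
-/
theorem IsStallingsGraph.reads_eq (h : Γ.IsStallingsGraph v H)
    (h' : Γ'.IsStallingsGraph v' H) {w₁ w₂ : List (A × Bool)} (hw₁ : FreeGroup.IsReduced w₁)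
    {u : V} (h₁ : Γ.Reads v w₁ u) (h₂ : Γ.Reads v w₂ u) {u₁ u₂ : V'}
    (h₁' : Γ'.Reads v' w₁ u₁) (h₂' : Γ'.Reads v' w₂ u₂) : u₁ = u₂ := by
  obtain ⟨w, hw, hmk⟩ := exists_isReduced (FreeGroup.mk (w₁ ++ FreeGroup.invRev w₂))
  have hmem := h.mk_mem (reads_append.2 ⟨u, h₁, h₂.invRev⟩)
  rw [← hmk] at hmem
  have hloop := reads_append.2 ⟨v', h'.reads_of_mk_mem hw hmem, h₂'⟩
  refine h₁'.det (hloop.of_mk_eq ?_ hw₁)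
  rw [← FreeGroup.mul_mk, hmk, ← FreeGroup.mul_mk, ← FreeGroup.inv_mk, inv_mul_cancel_right]

theorem IsStallingsGraph.step_of_step [Finite A] (h : Γ.IsStallingsGraph v H)
    (h' : Γ'.IsStallingsGraph v' H) {w₁ w₂ : List (A × Bool)} (hw₁ : FreeGroup.IsReduced w₁)
    {u t : V} {x : A × Bool} (hx : Γ.Step u x t)
    (h₁ : Γ.Reads v w₁ u) (h₂ : Γ.Reads v w₂ t) {u' t' : V'}
    (h₁' : Γ'.Reads v' w₁ u') (h₂' : Γ'.Reads v' w₂ t') : Γ'.Step u' x t' := by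
  by_cases hred : FreeGroup.IsReduced (w₁ ++ [x])
  · have hr : Γ.Reads v (w₁ ++ [x]) t := reads_append.2 ⟨u, h₁, reads_singleton.2 hx⟩
    obtain ⟨s', hs'⟩ := h.exists_reads h' hred hr
    obtain rfl := h.reads_eq h' hred hr h₂ hs' h₂'
    obtain ⟨q, hq, hqx⟩ := reads_append.1 hs'
    obtain rfl := hq.det h₁'
    exact reads_singleton.1 hqx
  -- If appending x cancels, w₁ ends with the inverse of x. Its last step, reversed, is then the
  -- required edge.
  · have hlast : ∃ w, w₁ = w ++ [(x.1, !x.2)] := by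
      rcases List.eq_nil_or_concat' w₁ with rfl | ⟨w, y, rfl⟩
      · exact absurd FreeGroup.IsReduced.singleton hred
      · refine ⟨w, ?_⟩
        by_contra hne
        refine hred (List.IsChain.append hw₁ FreeGroup.IsReduced.singleton ?_)
        simp only [List.getLast?_append, List.getLast?_singleton, Option.some_or, Option.mem_def,
          Option.some.injEq, List.head?_cons, forall_eq']
        intro h1
        by_contra h2
        refine hne ?_
        congr 2
        exact Prod.ext h1 (by cases hy : y.2 <;> cases hz : x.2 <;> simp_all)
    obtain ⟨w, rfl⟩ := hlast
    obtain ⟨q, hq, hqx⟩ := reads_append.1 h₁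
    obtain ⟨q', hq', hqx'⟩ := reads_append.1 h₁'
    obtain rfl : q = t := (step_inv.1 (reads_singleton.1 hqx)).det hx
    obtain rfl := h.reads_eq h' (hw₁.infix (List.prefix_append _ _).isInfix) hq h₂ hq' h₂'
    exact step_inv.1 (reads_singleton.1 hqx')

/-- A vertex goes to the endpoint in Γ' of any reduced word leading to it from the base; `reads_eq`
makes the choice immaterial. -/
theorem IsStallingsGraph.exists_map [Finite A] (h : Γ.IsStallingsGraph v H)
    (h' : Γ'.IsStallingsGraph v' H) :
    ∃ f : V → V', ∀ w u, FreeGroup.IsReduced w → Γ.Reads v w u → Γ'.Reads v' w (f u) := by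
  choose w hw hr using AGraph.exists_reads h.admissible.connected v
  choose f hf using fun u => h.exists_reads h' (hw u) (hr u)
  refine ⟨f, fun w₁ u hw₁ hr₁ => ?_⟩
  obtain ⟨u', hu'⟩ := h.exists_reads h' hw₁ hr₁
  obtain rfl := h.reads_eq h' hw₁ hr₁ (hr u) hu' (hf u)
  exact hu'

theorem step_pos {u t : V} {a : A} : Γ.Step u (a, true) t ↔ (u, a, t) ∈ Γ.edges := by
  simp [Step]

/-- The Stallings graph of a subgroup is unique up to isomorphism. -/
theorem IsStallingsGraph.exists_equiv [Finite A] (h : Γ.IsStallingsGraph v H)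
    (h' : Γ'.IsStallingsGraph v' H) :
    ∃ e : V ≃ V', e v = v' ∧ ∀ u a t, (u, a, t) ∈ Γ.edges ↔ (e u, a, e t) ∈ Γ'.edges := by
  obtain ⟨f, hf⟩ := h.exists_map h'
  obtain ⟨g, hg⟩ := h'.exists_map h
  have hgf : ∀ u, g (f u) = u := fun u => by
    obtain ⟨w, hw, hr⟩ := AGraph.exists_reads h.admissible.connected v u
    exact (hg w _ hw (hf w _ hw hr)).det hr
  have hfg : ∀ u, f (g u) = u := fun u => by
    obtain ⟨w, hw, hr⟩ := AGraph.exists_reads h'.admissible.connected v' u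
    exact (hf w _ hw (hg w _ hw hr)).det hr
  refine ⟨⟨f, g, hgf, hfg⟩, (hf [] v FreeGroup.IsReduced.nil rfl).symm, fun u a t => ?_⟩
  obtain ⟨w₁, hw₁, hr₁⟩ := AGraph.exists_reads h.admissible.connected v u
  obtain ⟨w₂, hw₂, hr₂⟩ := AGraph.exists_reads h.admissible.connected v t
  rw [← step_pos, ← step_pos]
  exact ⟨fun hs => h.step_of_step h' hw₁ hs hr₁ hr₂ (hf _ _ hw₁ hr₁) (hf _ _ hw₂ hr₂),
    fun hs => h'.step_of_step h hw₁ hs (hf _ _ hw₁ hr₁) (hf _ _ hw₂ hr₂) hr₁ hr₂⟩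

end Uniqueness

/-! ### Relabelling vertices, and n! labelled pairs per subgroup -/

section Transport

/-- Relabelling the vertices of an `A`-graph. -/
def map (e : V ≃ V') (Γ : AGraph A V) : AGraph A V' where
  edges := {p | (e.symm p.1, p.2.1, e.symm p.2.2) ∈ Γ.edges}
  det _ _ _ _ h h' := e.symm.injective (Γ.det _ _ _ _ h h')
  codet _ _ _ _ h h' := e.symm.injective (Γ.codet _ _ _ _ h h')

theorem mem_map_edges {e : V ≃ V'} {u t : V} {a : A} :
    (e u, a, e t) ∈ (Γ.map e).edges ↔ (u, a, t) ∈ Γ.edges := by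
  simp [map]

theorem step_map {e : V ≃ V'} {u t : V} {x : A × Bool} :
    (Γ.map e).Step (e u) x (e t) ↔ Γ.Step u x t := by
  simp only [Step, mem_map_edges]

theorem reads_map {e : V ≃ V'} {u t : V} {w : List (A × Bool)} :
    (Γ.map e).Reads (e u) w (e t) ↔ Γ.Reads u w t := by
  induction w generalizing u with
  | nil => exact e.injective.eq_iff
  | cons x w ih =>
    rw [reads_cons, reads_cons, e.surjective.exists]
    simp only [step_map, ih]

theorem underlying_map_adj {e : V ≃ V'} {u t : V} :
    (Γ.map e).underlying.Adj (e u) (e t) ↔ Γ.underlying.Adj u t := by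
  simp [underlying, SimpleGraph.fromRel_adj, mem_map_edges]

theorem degree_map {e : V ≃ V'} {u : V} : (Γ.map e).degree (e u) = Γ.degree u := by
  set F : V × A × V ≃ V' × A × V' := e.prodCongr ((Equiv.refl A).prodCongr e) with hF
  have hmem : ∀ p, F p ∈ (Γ.map e).edges ↔ p ∈ Γ.edges := fun ⟨p, a, q⟩ => mem_map_edges
  have h1 : F ⁻¹' {p | p ∈ (Γ.map e).edges ∧ p.1 = e u} = {p | p ∈ Γ.edges ∧ p.1 = u} := by
    ext p
    exact and_congr (hmem p) e.injective.eq_iff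
  have h2 : F ⁻¹' {p | p ∈ (Γ.map e).edges ∧ p.2.2 = e u} = {p | p ∈ Γ.edges ∧ p.2.2 = u} := by
    ext p
    exact and_congr (hmem p) e.injective.eq_iff
  rw [degree, degree, ← h1, ← h2, Set.encard_preimage_of_bijective F.bijective,
    Set.encard_preimage_of_bijective F.bijective]

theorem IsStallingsGraph.map {v : V} {H : Subgroup (FreeGroup A)} (h : Γ.IsStallingsGraph v H)
    (e : V ≃ V') : (Γ.map e).IsStallingsGraph (e v) H := by
  refine ⟨⟨?_, ?_, ?_⟩, fun w hw => (h.mem_iff w hw).trans reads_map.symm⟩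
  · have := h.admissible.finite
    exact Finite.of_equiv V e
  · have iso : Γ.underlying ≃g (Γ.map e).underlying := ⟨e, underlying_map_adj⟩
    exact iso.connected_iff.1 h.admissible.connected
  · intro w hw
    obtain ⟨u, rfl⟩ := e.surjective w
    rw [IsLeaf, degree_map]
    exact h.admissible.trim u fun hu => hw (congrArg e hu)

/-- Relabelling acts freely on pointed connected `A`-graphs. -/
theorem map_injective {v : V} (h : Γ.underlying.Connected) {e e' : V ≃ V'}
    (hΓ : Γ.map e = Γ.map e') (hv : e v = e' v) : e = e' := by
  ext u
  obtain ⟨w, -, hw⟩ := AGraph.exists_reads h v u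
  have h1 := (reads_map (e := e)).2 hw
  have h2 := (reads_map (e := e')).2 hw
  rw [hΓ, hv] at h1
  exact h1.det h2

/-- The symmetric group acts on these pairs transitively by `exists_equiv` and freely by
`map_injective`. -/
theorem IsStallingsGraph.natCard_labellings [Finite A] {n : ℕ} {Γ : AGraph A (Fin n)} {v : Fin n}
    {H : Subgroup (FreeGroup A)} (h : Γ.IsStallingsGraph v H) :
    Nat.card {p : AGraph A (Fin n) × Fin n // p.1.IsStallingsGraph p.2 H} = n.factorial := by
  have hb : Function.Bijective (fun e : Equiv.Perm (Fin n) =>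
      (⟨(Γ.map e, e v), h.map e⟩ :
        {p : AGraph A (Fin n) × Fin n // p.1.IsStallingsGraph p.2 H})) := by
    constructor
    · intro e e' hee
      simp only [Subtype.mk.injEq, Prod.mk.injEq] at hee
      exact map_injective h.admissible.connected hee.1 hee.2
    · rintro ⟨⟨Γ', v'⟩, h'⟩
      obtain ⟨e, hv, he⟩ := h.exists_equiv h'
      refine ⟨e, Subtype.ext (Prod.ext (edges_injective ?_) hv)⟩
      ext ⟨p, a, q⟩
      obtain ⟨p, rfl⟩ := e.surjective p
      obtain ⟨q, rfl⟩ := e.surjective q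
      exact mem_map_edges.trans (he p a q)
  rw [← Nat.card_congr (Equiv.ofBijective _ hb), Nat.card_perm, Nat.card_fin]

theorem natCard_isStallingsGraph [Finite A] (n : ℕ) (P : Subgroup (FreeGroup A) → Prop) :
    Nat.card {p : AGraph A (Fin n) × Fin n // ∃ H, p.1.IsStallingsGraph p.2 H ∧ P H} =
      {H | H ∈ subgroupsOfSize A n ∧ P H}.ncard * n.factorial := by
  set S := {H | H ∈ subgroupsOfSize A n ∧ P H} with hS
  have hfin : S.Finite := (finite_subgroupsOfSize A n).subset fun H hH => hH.1
  have := hfin.fintype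
  have hb : Function.Bijective
      (fun q : Σ H : S, {p : AGraph A (Fin n) × Fin n // p.1.IsStallingsGraph p.2 H} =>
      (⟨q.2.1, q.1.1, q.2.2, q.1.2.2⟩ :
        {p : AGraph A (Fin n) × Fin n // ∃ H, p.1.IsStallingsGraph p.2 H ∧ P H})) := by
    constructor
    · rintro ⟨⟨H, hH⟩, p, hp⟩ ⟨⟨H', hH'⟩, p', hp'⟩ heq
      obtain rfl : p = p' := congrArg Subtype.val heq
      obtain rfl : H = H' := hp.subgroup_unique hp'
      rfl
    · rintro ⟨p, H, hp, hPH⟩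
      exact ⟨⟨⟨H, ⟨p.1, p.2, hp⟩, hPH⟩, p, hp⟩, rfl⟩
  rw [← Nat.card_congr (Equiv.ofBijective _ hb), Nat.card_sigma]
  have hc : ∀ H : S, Nat.card {p : AGraph A (Fin n) × Fin n // p.1.IsStallingsGraph p.2 H} =
      n.factorial := by
    rintro ⟨H, ⟨Γ, v, h⟩, -⟩
    exact h.natCard_labellings
  simp only [hc, Finset.sum_const, Finset.card_univ, smul_eq_mul]
  rw [← Nat.card_eq_fintype_card, Nat.card_coe_set_eq]

end Transport

/-! ### From labelled pairs to the limit for subgroups -/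

theorem sizeProbability_eq [Finite A] {n : ℕ} (hn : n ≠ 0) :
    sizeProbability A n AvoidsGenerators =
      fraction (fun p : AGraph A (Fin n) × Fin n =>
        p.1.Admissible p.2 ∧ ∀ a u, (u, a, u) ∉ p.1.edges) /
      fraction (fun p : AGraph A (Fin n) × Fin n => p.1.Admissible p.2) := by
  have h1 := natCard_isStallingsGraph (A := A) n AvoidsGenerators
  have h2 := natCard_isStallingsGraph (A := A) n fun _ => True
  simp only [and_true, Set.ofPred_mem_eq] at h2
  have e1 : Nat.card {p : AGraph A (Fin n) × Fin n //
      ∃ H, p.1.IsStallingsGraph p.2 H ∧ AvoidsGenerators H} =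
      Nat.card {p : AGraph A (Fin n) × Fin n //
        p.1.Admissible p.2 ∧ ∀ a u, (u, a, u) ∉ p.1.edges} :=
    Nat.card_congr (Equiv.subtypeEquivRight fun p =>
      ⟨fun ⟨H, h, hH⟩ => ⟨h.admissible, h.avoidsGenerators_iff.1 hH⟩,
        fun h => ⟨_, h.1.isStallingsGraph, h.1.isStallingsGraph.avoidsGenerators_iff.2 h.2⟩⟩)
  have e2 : Nat.card {p : AGraph A (Fin n) × Fin n // ∃ H, p.1.IsStallingsGraph p.2 H} =
      Nat.card {p : AGraph A (Fin n) × Fin n // p.1.Admissible p.2} :=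
    Nat.card_congr (Equiv.subtypeEquivRight fun p =>
      ⟨fun ⟨H, h⟩ => h.admissible, fun h => ⟨_, h.isStallingsGraph⟩⟩)
  have : Nonempty (AGraph A (Fin n)) := ⟨(equivPi A (Fin n)).symm fun _ => Classical.arbitrary _⟩
  have : Nonempty (Fin n) := ⟨⟨0, Nat.pos_of_ne_zero hn⟩⟩
  have h0 : (Nat.card (AGraph A (Fin n) × Fin n) : ℝ) ≠ 0 := by exact_mod_cast Nat.card_pos.ne'
  rw [fraction, fraction, div_div_div_cancel_right₀ h0, ← e1, ← e2, h1, h2, sizeProbability]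
  push_cast
  rw [mul_div_mul_right _ _ (by positivity)]

theorem fraction_fst {X Y : Type*} [Finite Y] [Nonempty Y] (p : X → Prop) :
    fraction (fun q : X × Y => p q.1) = fraction p := by
  have e : {q : X × Y // p q.1} ≃ {x // p x} × Y :=
    ⟨fun q => (⟨q.1.1, q.2⟩, q.1.2), fun q => ⟨(q.1.1, q.2), q.1.2⟩, fun _ => rfl, fun _ => rfl⟩
  rw [fraction, fraction, Nat.card_congr e, Nat.card_prod, Nat.card_prod]
  push_cast
  exact mul_div_mul_right _ _ (by exact_mod_cast Nat.card_pos.ne')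

theorem fraction_le_and_add {X : Type*} [Finite X] {p q r : X → Prop}
    (h : ∀ x, r x ∨ p x) : fraction q ≤ fraction (fun x => p x ∧ q x) + fraction r := by
  refine (fraction_mono fun x hx => ?_).trans (fraction_or_le _ _)
  exact (h x).elim Or.inr fun hp => Or.inl ⟨hp, hx⟩

/-- A connected graph without leaves is admissible at every base vertex, so admissibility costs at
most the vanishing proportion in `tendsto_fraction_bad`. -/
theorem tendsto_fraction_admissible_and [Fintype A] (hr : 2 ≤ Fintype.card A)
    (q : ∀ n, AGraph A (Fin n) → Prop) {l : ℝ}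
    (hq : Filter.Tendsto (fun n => fraction (q n)) Filter.atTop (nhds l)) :
    Filter.Tendsto (fun n => fraction (fun p : AGraph A (Fin n) × Fin n =>
      p.1.Admissible p.2 ∧ q n p.1)) Filter.atTop (nhds l) := by
  have hlow := hq.sub (tendsto_fraction_bad hr)
  rw [sub_zero] at hlow
  refine tendsto_of_tendsto_of_tendsto_of_le_of_le' hlow hq ?_ ?_
  · filter_upwards [Filter.eventually_ne_atTop 0] with n hn
    have : Nonempty (Fin n) := ⟨⟨0, Nat.pos_of_ne_zero hn⟩⟩
    rw [← fraction_fst (Y := Fin n) (q n), ← fraction_fst (Y := Fin n)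
      (fun Γ : AGraph A (Fin n) => ¬ (Γ.underlying.Connected ∧ ∀ w, ¬ Γ.IsLeaf w)),
      sub_le_iff_le_add]
    refine fraction_le_and_add (p := fun x : AGraph A (Fin n) × Fin n => x.1.Admissible x.2)
      fun x => ?_
    by_cases hx : x.1.underlying.Connected ∧ ∀ w, ¬ x.1.IsLeaf w
    · exact Or.inr ⟨inferInstance, hx.1, fun w _ => hx.2 w⟩
    · exact Or.inl hx
  · filter_upwards [Filter.eventually_ne_atTop 0] with n hn
    have : Nonempty (Fin n) := ⟨⟨0, Nat.pos_of_ne_zero hn⟩⟩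
    rw [← fraction_fst (Y := Fin n) (q n)]
    exact fraction_mono fun p hp => hp.2

theorem tendsto_sizeProbability_avoidsGenerators [Fintype A] (hr : 2 ≤ Fintype.card A) :
    Filter.Tendsto (fun n : ℕ => sizeProbability A n AvoidsGenerators) Filter.atTop
      (nhds (Real.exp (-(Fintype.card A : ℝ)))) := by
  have hnum := tendsto_fraction_admissible_and hr
    (fun n (Γ : AGraph A (Fin n)) => ∀ a u, (u, a, u) ∉ Γ.edges) tendsto_fraction_loopless
  have hden := tendsto_fraction_admissible_and hr (fun n (_ : AGraph A (Fin n)) => True)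
    (l := 1) (tendsto_const_nhds.congr fun n => by
      have : Nonempty (AGraph A (Fin n)) :=
        ⟨(equivPi A (Fin n)).symm fun _ => Classical.arbitrary _⟩
      exact fraction_true.symm)
  simp only [and_true] at hden
  have h := hnum.div hden one_ne_zero
  rw [div_one] at h
  refine h.congr' ?_
  filter_upwards [Filter.eventually_ne_atTop 0] with n hn
  exact (sizeProbability_eq hn).symm

end AGraph

theorem mainTheorem5 {A : Type*} [Fintype A] (hr : 2 ≤ Fintype.card A) :
    Filter.Tendsto (fun n : ℕ => sizeProbability A n AvoidsGenerators) Filter.atTop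
      (nhds (Real.exp (-(Fintype.card A : ℝ)))) ∧
    ∀ {V : Type*} (Γ : AGraph A V) (v : V) (H : Subgroup (FreeGroup A)),
      Γ.IsStallingsGraph v H →
        (AvoidsGenerators H ↔ ∀ (a : A) (u : V), (u, a, u) ∉ Γ.edges) :=
  ⟨AGraph.tendsto_sizeProbability_avoidsGenerators hr,
    fun _ _ _ h => h.avoidsGenerators_iff⟩
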